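/- Let $\mathbb T^2=\mathbb R^2/\mathbb Z^2$ with fundamental cell $(-\frac12,\frac12]^2$. Let $\Delta^{-1}$ be the inverse Laplacian on $\mathbb T^2$, with values in functions of mean zero, that is, the Fourier multiplier $-1/(4\pi^2|k|^2)$ for $k\in\mathbb Z^2\setminus\{0\}$ and $0$ for $k=0$. Put $\operatorname{sgn}(x)=1$ for $x>0$ and $\operatorname{sgn}(x)=-1$ for $x\le 0$, and let $\psi_0=\Delta^{-1}[\operatorname{sgn}(x)\operatorname{sgn}(y)]$ (with $\operatorname{sgn}(x)\operatorname{sgn}(y)$ given by this formula on the cell) be the stream function of the Bahouri-Chemin patch. Let $K:\mathbb R\to\mathbb R$ be a smooth, non-negative, even function vanishing outside $(-1,1)$ with $\int_{\mathbb R}K=1$. For $\epsilon>0$ let $K_\epsilon(x)=\frac1\epsilon K(\frac x\epsilon)$ and $F_\epsilon=-\operatorname{sgn}*K_\epsilon$. A function on $\mathbb T^2$ is called odd-odd if it is odd in $x$ and odd in $y$. Write $\|f\|_{C^1(\mathbb T^2)}=\sup|f|+\sup|\nabla f|$. **Theorem.** For every such $K$ and every $C_1>0$ there is an $\epsilon_0>0$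 such that the following holds for all $0<\epsilon<\epsilon_0$. If $\psi^1$ and $\psi^2$ are odd-odd functions on $\mathbb T^2$ which solve $$\Delta\psi=F_\epsilon(\psi)$$ on $\mathbb T^2$ in the sense of distributions, and for both $\psi=\psi^1$ and $\psi=\psi^2$ the difference $\psi-\psi_0$ is a $C^1$ function with $$\|\psi-\psi_0\|_{C^1(\mathbb T^2)}<C_1\sqrt{\epsilon}\,\sqrt{-\ln\epsilon}\,\ln(-\ln\epsilon),$$ then $\psi^1=\psi^2$. -/

import Mathlib

open MeasureTheory Set
open scoped ContDiff ENNReal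

noncomputable section

namespace BahouriChemin

/-- The Euclidean plane. Functions on the torus `ℝ² / ℤ²` are written as `ℤ²`-periodic functions
on it. -/
abbrev Plane : Type := EuclideanSpace ℝ (Fin 2)

/-- The fundamental cell `(-1/2, 1/2]²` of the torus. -/
def cell : Set Plane := {z | ∀ i, z i ∈ Ioc (-(1 / 2) : ℝ) (1 / 2)}

/-- `f` is a function on the torus: it has period `1` in each coordinate. -/
def TorusPeriodic (f : Plane → ℝ) : Prop :=
  ∀ x y : ℝ, f !₂[x + 1, y] = f !₂[x, y] ∧ f !₂[x, y + 1] = f !₂[x, y]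

/-- `f` is odd in `x` and odd in `y`. -/
def OddOdd (f : Plane → ℝ) : Prop :=
  ∀ x y : ℝ, f !₂[-x, y] = -f !₂[x, y] ∧ f !₂[x, -y] = -f !₂[x, y]

/-- The sign function, with value `-1` at `0`. -/
def sgn (x : ℝ) : ℝ := if 0 < x then 1 else -1

/-- The Fourier character `z ↦ exp (2 π i k · z)` of the torus. -/
def character (k : ℤ × ℤ) (z : Plane) : ℂ :=
  Complex.exp (2 * Real.pi * Complex.I * ((k.1 : ℂ) * (z 0 : ℂ) + (k.2 : ℂ) * (z 1 : ℂ)))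

/-- The Fourier coefficient `∫ w(z) exp (-2 π i k · z) dz` over the torus; only the values of `w`
on the cell are used. -/
def fourierCoefficient (w : Plane → ℝ) (k : ℤ × ℤ) : ℂ :=
  ∫ z in cell, (w z : ℂ) * character (-k) z

/-- The inverse Laplacian on the torus, with values in functions of mean zero: the Fourier
multiplier `-1 / (4 π² |k|²)` for `k ≠ 0`, and `0` for `k = 0`. For square integrable `w` the
series converges absolutely. -/
def invLaplacian (w : Plane → ℝ) (z : Plane) : ℝ :=
  (∑' k : ℤ × ℤ, if k = 0 then 0 else
    -(fourierCoefficient w k / (4 * (Real.pi : ℂ) ^ 2 * ((k.1 : ℂ) ^ 2 + (k.2 : ℂ) ^ 2)))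
      * character k z).re

/-- The stream function of the Bahouri-Chemin patch. -/
def psi0 : Plane → ℝ := invLaplacian fun z => sgn (z 0) * sgn (z 1)

/-- `K` is a smooth, non-negative, even function supported in the unit ball, of integral `1`. -/
structure IsMollifier (K : ℝ → ℝ) : Prop where
  smooth : ContDiff ℝ ∞ K
  nonneg : ∀ x, 0 ≤ K x
  even : ∀ x, K (-x) = K x
  support_subset : Function.support K ⊆ Metric.ball 0 1
  integral_eq_one : ∫ x, K x = 1

/-- The rescaled function `K_δ(x) = K(x / δ) / δ`. -/
def rescale (K : ℝ → ℝ) (δ x : ℝ) : ℝ := (1 / δ) * K (x / δ)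

/-- `F_ε = -sgn * K_ε`. -/
def Feps (K : ℝ → ℝ) (ε x : ℝ) : ℝ :=
  -(convolution sgn (rescale K ε) (ContinuousLinearMap.mul ℝ ℝ) volume x)

/-- `ψ` solves `Δ ψ = F(ψ)` on the torus in the sense of distributions: it is tested against
all smooth functions on the torus. -/
def SolvesLaplaceEq (F : ℝ → ℝ) (ψ : Plane → ℝ) : Prop :=
  ∀ φ : Plane → ℝ, ContDiff ℝ ∞ φ → TorusPeriodic φ →
    ∫ z in cell, ψ z * Laplacian.laplacian φ z = ∫ z in cell, F (ψ z) * φ z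

/-- The `C¹` norm `sup |f| + sup |∇ f|` of a `C¹` function, in `[0, ∞]`. -/
def c1Norm (f : Plane → ℝ) : ℝ≥0∞ := (⨆ z, ‖f z‖ₑ) + ⨆ z, ‖fderiv ℝ f z‖ₑ

/-- The difference `f - g` is a `C¹` function of `C¹` norm less than `R`. -/
def InC1Ball (g : Plane → ℝ) (R : ℝ) (f : Plane → ℝ) : Prop :=
  ContDiff ℝ 1 (f - g) ∧ c1Norm (f - g) < ENNReal.ofReal R

/-- The radius `C √ε √(-ln ε) ln(-ln ε)`. -/
def radius (C ε : ℝ) : ℝ :=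
  C * √ε * √(-Real.log ε) * Real.log (-Real.log ε)

end BahouriChemin

end

/-! Let R be the radius of the ball and w = ψ₁ - ψ₂. Then Δw = g weakly with g = F_ε(ψ₁) - F_ε(ψ₂).
Two facts about g force w = 0. Since F_ε is Lipschitz with constant L = 2M/ε, where K ≤ M, |g| ≤
L|w|. Moreover g vanishes unless some coordinate lies within δ of a half-integer, for a width δ
small against √ε. All functions involved vanish on that grid by oddness and periodicity, so a
one-dimensional Poincaré inequality bounds the integral of w² over such strips by 4δ² times the
Dirichlet energy E of w. The energy identity E = -∫ g w then gives E ≤ 4Lδ²E with 4Lδ² < 1, hence E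
= 0 and w = 0 (`eq_zero_of_weak_solution`).

The support of g is controlled by a lower bound on ψ₀. With a, b the distances of the coordinates to
the half-integers, |ψ₀| ≥ ab ln(1/(2 max(a,b)))/400 (`abs_psi0_ge`), while |ψᵢ - ψ₀| ≤ R min(a,b).
If a, b ≥ δ, the first bound exceeds ε + R min(a,b) as soon as δR ≥ ε and max(a,b) ln(1/(2
max(a,b))) ≥ 800R. Then ψ₁ and ψ₂ lie beyond the same one of ±ε, where F_ε is constant. Up to
constants the two conditions ask for δ ≥ ε/R and δ ≥ R/(-ln ε), and for the given R both right sides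
are o(√ε) (`exists_width`).

The logarithm in the bound on ψ₀ comes from its series, a sum over odd m, n of sin(mX)
sin(nY)/(mn(m²+n²)). Writing 1/(m²+n²) as the integral of e^{-|m|s} sin(|n|s)/|n| over s > 0
separates the variables. The sum over m becomes arctan(sin X / sinh s), the sum over n becomes the
tent π/2 min(Y, s) for small s, extended antiperiodically. The antiperiodicity pairs intervals of
length π into nonnegative contributions. The first of them contains a range of s on which the
integrand is at least of order XY/s, and this integrates to the logarithm (`tsum_doubleSine_ge`). -/

noncomputable section

namespace BahouriChemin

/-! ### Harmonic extension of the square wave -/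

lemma hasSum_int_of_even {f : ℤ → ℝ} {S : ℝ} (hf : ∀ n, f (-n) = f n) (h0 : f 0 = 0)
    (h : HasSum (fun n : ℕ => f n) S) : HasSum f (2 * S) := by
  have := HasSum.of_nat_of_neg (f := f) h (by simpa [hf] using h)
  simpa [h0, two_mul] using this

/-- The reciprocal of odd integers, and zero at even integers. -/
def oddInv (m : ℤ) : ℝ := if Odd m then (m : ℝ)⁻¹ else 0

lemma oddInv_neg (m : ℤ) : oddInv (-m) = -oddInv m := by
  unfold oddInv
  simp only [odd_neg]
  split_ifs <;> simp [inv_neg]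

lemma oddInv_zero : oddInv 0 = 0 := by simp [oddInv]

lemma oddInv_natCast (n : ℕ) : oddInv n = if Odd n then (n : ℝ)⁻¹ else 0 := by
  simp [oddInv, Int.odd_coe_nat]

lemma arg_eq_arctan {z : ℂ} (hz : 0 < z.re) : z.arg = Real.arctan (z.im / z.re) := by
  refine (Real.arctan_eq_of_tan_eq (Complex.tan_arg z) ?_).symm
  have := (Complex.abs_arg_lt_pi_div_two_iff (z := z)).2 (Or.inl hz)
  exact abs_lt.1 this

/-- The two arguments are arctangents and add up to arctan(2 Im z / (1 - |z|²)). With |z| = e^{-s}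
this quotient is sin X / sinh s. -/
lemma log_sub_log_im (X : ℝ) {s : ℝ} (hs : 0 < s) :
    (Complex.log (1 + Complex.exp (-s + X * Complex.I))
      - Complex.log (1 - Complex.exp (-s + X * Complex.I))).im
      = Real.arctan (Real.sin X / Real.sinh s) := by
  set z := Complex.exp (-s + X * Complex.I) with hz
  have hre : z.re = Real.exp (-s) * Real.cos X := by
    simp [hz, Complex.exp_re]
  have him : z.im = Real.exp (-s) * Real.sin X := by
    simp [hz, Complex.exp_im]
  have he1 : Real.exp (-s) < 1 := by simpa using hs
  have he0 : 0 < Real.exp (-s) := Real.exp_pos _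
  have hsq : z.re ^ 2 + z.im ^ 2 = Real.exp (-s) ^ 2 := by
    rw [hre, him]; nlinarith [Real.sin_sq_add_cos_sq X]
  have hlt : z.re ^ 2 + z.im ^ 2 < 1 := by rw [hsq]; nlinarith
  have h1 : 0 < 1 + z.re := by nlinarith [sq_nonneg z.im]
  have h2 : 0 < 1 - z.re := by nlinarith [sq_nonneg z.im]
  rw [Complex.sub_im, Complex.log_im, Complex.log_im, arg_eq_arctan (by simpa using h1),
    arg_eq_arctan (by simpa using h2)]
  simp only [Complex.add_re, Complex.add_im, Complex.sub_re, Complex.sub_im, Complex.one_re,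
    Complex.one_im, zero_add, zero_sub]
  rw [neg_div, Real.arctan_neg, sub_neg_eq_add, Real.arctan_add]
  · congr 1
    have hs' : Real.sinh s = (1 - Real.exp (-s) ^ 2) / (2 * Real.exp (-s)) := by
      rw [Real.sinh_eq, Real.exp_neg]; field_simp
    have h3 : (1 + z.re) * (1 - z.re) - z.im * z.im ≠ 0 := by
      have : (1 + z.re) * (1 - z.re) - z.im * z.im = 1 - (z.re ^ 2 + z.im ^ 2) := by ring
      rw [this]; linarith
    have h4 : 1 - Real.exp (-s) ^ 2 ≠ 0 := by nlinarith
    have h5 : z.im / (1 + z.re) + z.im / (1 - z.re)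
        = 2 * z.im / ((1 + z.re) * (1 - z.re)) := by field_simp; ring
    have h6 : 1 - z.im / (1 + z.re) * (z.im / (1 - z.re))
        = (1 - Real.exp (-s) ^ 2) / ((1 + z.re) * (1 - z.re)) := by
      rw [← hsq]; field_simp; ring
    rw [h5, h6, hs', him]
    have := h1.ne'
    have := h2.ne'
    field_simp
  · rw [div_mul_div_comm, div_lt_one (by positivity)]
    nlinarith

/-- The Fourier sine series of the harmonic extension of the square wave. -/
lemma hasSum_arctan_sin_div_sinh (X : ℝ) {s : ℝ} (hs : 0 < s) :
    HasSum (fun m : ℤ => oddInv m * Real.sin (m * X) * Real.exp (-|(m : ℝ)| * s))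
      (Real.arctan (Real.sin X / Real.sinh s)) := by
  have hn : ‖Complex.exp (-s + X * Complex.I)‖ < 1 := by
    rw [Complex.norm_exp]; simpa using hs
  -- The sum of the two logarithm series is twice the series of the odd powers zⁿ/n. Halving it
  -- leaves half an arctangent, which the two-sided sum over ℤ doubles again.
  have h := ((Complex.hasSum_taylorSeries_log hn).add (Complex.hasSum_taylorSeries_neg_log hn))
  rw [← sub_eq_add_neg] at h
  have h' := (Complex.hasSum_im h).mul_left (1 / 2)
  rw [log_sub_log_im X hs] at h'
  have key := hasSum_int_of_even
    (f := fun m : ℤ => oddInv m * Real.sin (m * X) * Real.exp (-|(m : ℝ)| * s))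
    (S := 1 / 2 * Real.arctan (Real.sin X / Real.sinh s)) ?_ ?_ ?_
  · convert key using 1; ring
  · intro m; simp [oddInv_neg]
  · simp [oddInv_zero]
  · convert! h' using 2 with n
    rw [oddInv_natCast]
    have e : Complex.exp (-s + X * Complex.I) ^ n
        = Complex.exp (((-(n * s) : ℝ) : ℂ) + ((n * X : ℝ) : ℂ) * Complex.I) := by
      rw [← Complex.exp_nat_mul]; congr 1; push_cast; ring
    have im : (Complex.exp (-s + X * Complex.I) ^ n).im
        = Real.exp (-(n * s)) * Real.sin (n * X) := by
      rw [e, Complex.exp_im]; simp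
    by_cases hodd : Odd n
    · have : ((-1 : ℂ) ^ (n + 1)) = 1 := Even.neg_one_pow hodd.add_one
      rw [if_pos hodd, this, one_mul, Complex.add_im, ← Complex.ofReal_natCast, Complex.div_ofReal_im, im]
      simp only [Int.cast_natCast, Nat.abs_cast]
      rw [neg_mul]; ring
    · have h2 : ((-1 : ℂ) ^ (n + 1)) = -1 := Odd.neg_one_pow (Nat.not_odd_iff_even.1 hodd).add_one
      rw [if_neg hodd, h2]
      simp [neg_div]

/-! ### Cosine series over odd integers and the Green function of an interval -/

lemma hasSum_cos_div_sq {x : ℝ} (hx : x ∈ Icc (0 : ℝ) 1) :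
    HasSum (fun n : ℕ => 1 / (n : ℝ) ^ 2 * Real.cos (2 * Real.pi * n * x))
      (Real.pi ^ 2 * (x ^ 2 - x + 1 / 6)) := by
  have h := hasSum_one_div_nat_pow_mul_cos one_ne_zero hx
  have := bernoulliFun_two x
  unfold bernoulliFun at this
  rw [mul_one, this] at h
  convert! h using 1
  simp only [Nat.factorial]
  push_cast
  ring

/-- The odd part is the full Bernoulli series minus its even part, and the even part is a quarter of
the full series at the doubled angle. The quadratic terms cancel, leaving a linear function of θ. -/
lemma hasSum_odd_cos_div_sq {θ : ℝ} (h0 : 0 ≤ θ) (h1 : θ ≤ Real.pi) :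
    HasSum (fun n : ℕ => if Odd n then Real.cos (n * θ) / (n : ℝ) ^ 2 else 0)
      (Real.pi ^ 2 / 8 - Real.pi * θ / 4) := by
  have hp := Real.pi_pos
  have hx : θ / (2 * Real.pi) ∈ Icc (0 : ℝ) 1 := by
    constructor
    · positivity
    · rw [div_le_one (by positivity)]; linarith
  have hx2 : θ / Real.pi ∈ Icc (0 : ℝ) 1 := by
    constructor
    · positivity
    · rw [div_le_one (by positivity)]; linarith
  have A := hasSum_cos_div_sq hx
  have B := (hasSum_cos_div_sq hx2).mul_left (1 / 4)
  have inj : Function.Injective (fun j : ℕ => 2 * j) := fun a b h => by simpa using h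
  have C : HasSum (fun n : ℕ => if Even n then Real.cos (n * θ) / (n : ℝ) ^ 2 else 0)
      (1 / 4 * (Real.pi ^ 2 * ((θ / Real.pi) ^ 2 - θ / Real.pi + 1 / 6))) := by
    rw [← inj.hasSum_iff]
    · convert! B using 2 with j
      simp only [Function.comp, even_two_mul, if_true]
      push_cast
      rw [show 2 * Real.pi * j * (θ / Real.pi) = 2 * j * θ by field_simp]
      ring
    · intro n hn
      rw [if_neg]
      rintro ⟨j, rfl⟩
      exact hn ⟨j, by ring⟩
  convert! A.sub C using 1
  · funext n
    rw [show 2 * Real.pi * n * (θ / (2 * Real.pi)) = n * θ by field_simp]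
    by_cases h : Even n
    · rw [if_neg (Nat.not_odd_iff_even.2 h), if_pos h]; ring
    · rw [if_pos (Nat.not_even_iff_odd.1 h), if_neg h]; ring
  · field_simp; ring

/-- The sine series of the Green function of the interval with antiperiodic extension. -/
def greenSeries (Y s : ℝ) (n : ℤ) : ℝ :=
  oddInv n * Real.sin (n * Y) * (Real.sin (|(n : ℝ)| * s) / |(n : ℝ)|)

/-- Product-to-sum formula; the factor 1/2 disappears because positive and negative n contribute
equally. -/
lemma hasSum_greenSeries_of_cos {Y s a b : ℝ}
    (ha : HasSum (fun n : ℕ => if Odd n then Real.cos (n * (Y - s)) / (n : ℝ) ^ 2 else 0) a)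
    (hb : HasSum (fun n : ℕ => if Odd n then Real.cos (n * (Y + s)) / (n : ℝ) ^ 2 else 0) b) :
    HasSum (greenSeries Y s) (a - b) := by
  have key := hasSum_int_of_even (f := greenSeries Y s) (S := 1 / 2 * (a - b)) ?_ ?_ ?_
  · convert key using 1; ring
  · intro n; simp [greenSeries, oddInv_neg]
  · simp [greenSeries, oddInv_zero]
  · convert! (ha.sub hb).mul_left (1 / 2) using 2 with n
    simp only [greenSeries, oddInv_natCast, Int.cast_natCast, Nat.abs_cast]
    split_ifs with h
    · rw [mul_sub (n : ℝ), mul_add (n : ℝ), Real.cos_add, Real.cos_sub]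
      have : (n : ℝ) ≠ 0 := by exact_mod_cast h.pos.ne'
      field_simp; ring
    · simp

lemma hasSum_odd_cos_abs {θ : ℝ} (h1 : |θ| ≤ Real.pi) :
    HasSum (fun n : ℕ => if Odd n then Real.cos (n * θ) / (n : ℝ) ^ 2 else 0)
      (Real.pi ^ 2 / 8 - Real.pi * |θ| / 4) := by
  convert! hasSum_odd_cos_div_sq (abs_nonneg θ) h1 using 4 with n
  rw [← Real.cos_abs, abs_mul, Nat.abs_cast]

lemma hasSum_greenSeries_of_le {Y s : ℝ} (hY : 0 ≤ Y) (hs : 0 ≤ s) (h : Y + s ≤ Real.pi) :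
    HasSum (greenSeries Y s) (Real.pi / 2 * min Y s) := by
  have := hasSum_greenSeries_of_cos
    (hasSum_odd_cos_abs (θ := Y - s) (abs_le.2 ⟨by linarith, by linarith⟩))
    (hasSum_odd_cos_abs (θ := Y + s) (abs_le.2 ⟨by linarith, by linarith⟩))
  convert this using 1
  rw [abs_of_nonneg (by linarith : 0 ≤ Y + s)]
  rcases le_total Y s with h' | h'
  · rw [min_eq_left h', abs_of_nonpos (by linarith)]; ring
  · rw [min_eq_right h', abs_of_nonneg (by linarith)]; ring

/-- Here Y + s may leave the range of the linear formula; the symmetry of the cosine folds it back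
to 2π - (Y + s). -/
lemma hasSum_greenSeries_of_ge {Y s : ℝ} (hY : Y ≤ Real.pi) (hs : s ≤ Real.pi)
    (h : Real.pi ≤ Y + s) :
    HasSum (greenSeries Y s) (Real.pi / 2 * (Real.pi - max Y s)) := by
  have e : (fun n : ℕ => if Odd n then Real.cos (n * (Y + s)) / (n : ℝ) ^ 2 else 0)
      = fun n : ℕ => if Odd n then Real.cos (n * (2 * Real.pi - (Y + s))) / (n : ℝ) ^ 2 else 0 := by
    funext n
    rw [mul_sub, Real.cos_nat_mul_two_pi_sub]
  have hb := hasSum_odd_cos_abs (θ := 2 * Real.pi - (Y + s))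
    (abs_le.2 ⟨by linarith, by linarith⟩)
  rw [← e] at hb
  have := hasSum_greenSeries_of_cos
    (hasSum_odd_cos_abs (θ := Y - s) (abs_le.2 ⟨by linarith, by linarith⟩)) hb
  convert this using 1
  rw [abs_of_nonneg (by linarith : 0 ≤ 2 * Real.pi - (Y + s))]
  rcases le_total Y s with h' | h'
  · rw [max_eq_right h', abs_of_nonpos (by linarith)]; ring
  · rw [max_eq_left h', abs_of_nonneg (by linarith)]; ring

/-! ### Integral representation of the double sine series -/

/-- Separates the variables in 1/(μ² + ν²). Stopping at a whole number of periods of the sine keeps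
the boundary term elementary. -/
lemma integral_exp_neg_mul_sin {μ ν T : ℝ} (hμ : 0 < μ) (hs : Real.sin (ν * T) = 0)
    (hc : Real.cos (ν * T) = 1) :
    ∫ s in (0 : ℝ)..T, Real.exp (-μ * s) * Real.sin (ν * s)
      = ν * (1 - Real.exp (-μ * T)) / (μ ^ 2 + ν ^ 2) := by
  have hne : μ ^ 2 + ν ^ 2 ≠ 0 := by positivity
  have hd : ∀ s ∈ uIcc 0 T, HasDerivAt (fun s => -(Real.exp (-μ * s)
      * (μ * Real.sin (ν * s) + ν * Real.cos (ν * s))) / (μ ^ 2 + ν ^ 2))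
      (Real.exp (-μ * s) * Real.sin (ν * s)) s := by
    intro s _
    have h1 : HasDerivAt (fun s => Real.exp (-μ * s)) (Real.exp (-μ * s) * (-μ)) s := by
      simpa using ((hasDerivAt_id s).const_mul (-μ)).exp
    have h2 : HasDerivAt (fun s => Real.sin (ν * s)) (Real.cos (ν * s) * ν) s := by
      simpa using ((hasDerivAt_id s).const_mul ν).sin
    have h3 : HasDerivAt (fun s => Real.cos (ν * s)) (-Real.sin (ν * s) * ν) s := by
      simpa using ((hasDerivAt_id s).const_mul ν).cos
    convert! ((h1.mul ((h2.const_mul μ).add (h3.const_mul ν))).neg.div_const _) using 1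
    simp only [Pi.add_apply]
    field_simp
    ring
  rw [intervalIntegral.integral_eq_sub_of_hasDerivAt hd
    (Continuous.intervalIntegrable (by fun_prop) _ _), hs, hc]
  simp
  ring

lemma integral_exp_neg_le {μ T : ℝ} (hμ : 0 < μ) :
    ∫ s in (0 : ℝ)..T, Real.exp (-μ * s) ≤ μ⁻¹ := by
  have hd : ∀ s ∈ uIcc 0 T, HasDerivAt (fun s => -(Real.exp (-μ * s) / μ))
      (Real.exp (-μ * s)) s := by
    intro s _
    have h1 : HasDerivAt (fun s => Real.exp (-μ * s)) (Real.exp (-μ * s) * (-μ)) s := by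
      simpa using ((hasDerivAt_id s).const_mul (-μ)).exp
    convert! (h1.div_const μ).neg using 1
    field_simp
  rw [intervalIntegral.integral_eq_sub_of_hasDerivAt hd
    (Continuous.intervalIntegrable (by fun_prop) _ _)]
  have : 0 < Real.exp (-μ * T) / μ := by positivity
  simp only [mul_zero, Real.exp_zero, one_div]
  linarith

lemma abs_oddInv_le (m : ℤ) : |oddInv m| ≤ |(m : ℝ)|⁻¹ := by
  unfold oddInv
  split_ifs
  · rw [abs_inv]
  · simp

lemma summable_int_inv_sq : Summable (fun m : ℤ => |(m : ℝ)|⁻¹ * |(m : ℝ)|⁻¹) := by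
  convert Real.summable_one_div_int_pow.2 (one_lt_two) using 2 with m
  rw [← mul_inv, abs_mul_abs_self, one_div, sq]

lemma summable_int_prod_inv_sq :
    Summable (fun k : ℤ × ℤ =>
      (|(k.1 : ℝ)|⁻¹ * |(k.1 : ℝ)|⁻¹) * (|(k.2 : ℝ)|⁻¹ * |(k.2 : ℝ)|⁻¹)) :=
  summable_int_inv_sq.mul_of_nonneg summable_int_inv_sq (fun _ => by positivity)
    (fun _ => by positivity)

lemma abs_greenSeries_le (Y s : ℝ) (n : ℤ) :
    |greenSeries Y s n| ≤ |(n : ℝ)|⁻¹ * |(n : ℝ)|⁻¹ := by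
  unfold greenSeries
  rw [abs_mul, abs_mul, abs_div, abs_abs, div_eq_mul_inv, ← mul_assoc]
  have h1 := abs_oddInv_le n
  have h2 := Real.abs_sin_le_one (n * Y)
  have h3 := Real.abs_sin_le_one (|(n : ℝ)| * s)
  gcongr
  calc _ ≤ |(n : ℝ)|⁻¹ * 1 * 1 := by gcongr
    _ = _ := by ring

lemma summable_greenSeries (Y s : ℝ) : Summable (greenSeries Y s) :=
  summable_int_inv_sq.of_norm_bounded (abs_greenSeries_le Y s)

/-- The harmonic extension of the square wave. -/
def squareWaveExt (X s : ℝ) : ℝ := Real.arctan (Real.sin X / Real.sinh s)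

/-- The antiperiodic extension of the Green function of the interval. -/
def green (Y s : ℝ) : ℝ := ∑' n, greenSeries Y s n

lemma continuous_green (Y : ℝ) : Continuous (green Y) := by
  refine continuous_tsum (fun n => ?_) summable_int_inv_sq
    (fun n s => abs_greenSeries_le Y s n)
  unfold greenSeries
  fun_prop

/-- Only odd frequencies occur, and each of them changes sign under a shift by π. -/
lemma green_antiperiodic (Y : ℝ) : Function.Antiperiodic (green Y) Real.pi := by
  intro s
  unfold green
  rw [← tsum_neg]
  congr 1
  funext n
  unfold greenSeries oddInv
  split_ifs with h
  · have : Real.sin (|(n : ℝ)| * (s + Real.pi)) = -Real.sin (|(n : ℝ)| * s) := by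
      have hk : Odd n.natAbs := Int.natAbs_odd.2 h
      have e : |(n : ℝ)| = (n.natAbs : ℝ) := by rw [Nat.cast_natAbs]; simp
      rw [e, mul_add, Real.sin_add_nat_mul_pi, hk.neg_one_pow]
      ring
    rw [this]
    ring
  · simp

/-- The double sine series of the (scaled) stream function of the Bahouri-Chemin patch. -/
def doubleSine (X Y : ℝ) (k : ℤ × ℤ) : ℝ :=
  oddInv k.1 * Real.sin (k.1 * X) * (oddInv k.2 * Real.sin (k.2 * Y))
    / ((k.1 : ℝ) ^ 2 + (k.2 : ℝ) ^ 2)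

lemma abs_doubleSine_le (X Y : ℝ) (k : ℤ × ℤ) :
    |doubleSine X Y k| ≤
      (|(k.1 : ℝ)|⁻¹ * |(k.1 : ℝ)|⁻¹) * (|(k.2 : ℝ)|⁻¹ * |(k.2 : ℝ)|⁻¹) := by
  unfold doubleSine
  rw [abs_div, abs_mul, abs_mul, abs_mul]
  have h1 := abs_oddInv_le k.1
  have h2 := abs_oddInv_le k.2
  have h3 := Real.abs_sin_le_one (k.1 * X)
  have h4 := Real.abs_sin_le_one (k.2 * Y)
  by_cases hm : k.1 = 0
  · simp [hm, oddInv_zero]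
  by_cases hn : k.2 = 0
  · simp [hn, oddInv_zero]
  have hm' : 0 < |(k.1 : ℝ)| := by simpa using hm
  have hn' : 0 < |(k.2 : ℝ)| := by simpa using hn
  have h5 : |(k.1 : ℝ)| * |(k.2 : ℝ)| ≤ |(k.1 : ℝ) ^ 2 + (k.2 : ℝ) ^ 2| := by
    rw [abs_of_nonneg (by positivity : 0 ≤ (k.1 : ℝ) ^ 2 + (k.2 : ℝ) ^ 2)]
    nlinarith [sq_nonneg (|(k.1 : ℝ)| - |(k.2 : ℝ)|), sq_abs (k.1 : ℝ), sq_abs (k.2 : ℝ)]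
  calc _ ≤ (|(k.1 : ℝ)|⁻¹ * 1 * (|(k.2 : ℝ)|⁻¹ * 1)) / (|(k.1 : ℝ)| * |(k.2 : ℝ)|) := by
        gcongr
    _ = _ := by field_simp

lemma summable_doubleSine (X Y : ℝ) : Summable (doubleSine X Y) :=
  summable_int_prod_inv_sq.of_norm_bounded (abs_doubleSine_le X Y)

/-- Sum and integral may be exchanged because the integral of e^{-|m|s} is at most 1/|m|, which
makes the terms summable like m⁻²n⁻². The upper limit 2πN is a common period of all the sines. -/
lemma hasSum_integral_squareWaveExt_mul_green (X Y : ℝ) (N : ℕ) :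
    HasSum (fun k : ℤ × ℤ =>
        doubleSine X Y k * (1 - Real.exp (-|(k.1 : ℝ)| * (2 * Real.pi * N))))
      (∫ s in (0 : ℝ)..(2 * Real.pi * N), squareWaveExt X s * green Y s) := by
  set T : ℝ := 2 * Real.pi * N with hT
  have hT0 : 0 ≤ T := by positivity
  have hi : ∀ k : ℤ × ℤ, Integrable (fun s => oddInv k.1 * Real.sin (k.1 * X)
      * Real.exp (-|(k.1 : ℝ)| * s) * greenSeries Y s k.2) (volume.restrict (Ioc 0 T)) := by
    intro k
    have : Continuous (fun s => oddInv k.1 * Real.sin (k.1 * X)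
      * Real.exp (-|(k.1 : ℝ)| * s) * greenSeries Y s k.2) := by
      unfold greenSeries
      fun_prop
    exact (this.intervalIntegrable 0 T).1
  have hs : Summable fun k : ℤ × ℤ => ∫ s in Ioc 0 T, ‖oddInv k.1 * Real.sin (k.1 * X)
      * Real.exp (-|(k.1 : ℝ)| * s) * greenSeries Y s k.2‖ := by
    refine summable_int_prod_inv_sq.of_nonneg_of_le
      (fun k => integral_nonneg fun s => norm_nonneg _) (fun k => ?_)
    by_cases hm : k.1 = 0
    · simp [hm, oddInv_zero]
    have hm' : 0 < |(k.1 : ℝ)| := by simpa using hm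
    calc _ ≤ ∫ s in Ioc 0 T, (|(k.1 : ℝ)|⁻¹ * (|(k.2 : ℝ)|⁻¹ * |(k.2 : ℝ)|⁻¹))
              * Real.exp (-|(k.1 : ℝ)| * s) := by
          refine integral_mono (hi k).norm ?_ (fun s => ?_)
          · have : Continuous (fun s => (|(k.1 : ℝ)|⁻¹ * (|(k.2 : ℝ)|⁻¹ * |(k.2 : ℝ)|⁻¹))
              * Real.exp (-|(k.1 : ℝ)| * s)) := by fun_prop
            exact (this.intervalIntegrable 0 T).1
          · have h1 := abs_oddInv_le k.1
            have h2 := abs_greenSeries_le Y s k.2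
            have h3 := Real.abs_sin_le_one (k.1 * X)
            simp only [norm_mul, Real.norm_eq_abs, Real.abs_exp]
            calc _ ≤ |(k.1 : ℝ)|⁻¹ * 1 * Real.exp (-|(k.1 : ℝ)| * s)
                      * (|(k.2 : ℝ)|⁻¹ * |(k.2 : ℝ)|⁻¹) := by gcongr
              _ = _ := by ring
      _ ≤ _ := by
          rw [integral_const_mul, ← intervalIntegral.integral_of_le hT0]
          have := integral_exp_neg_le (T := T) hm'
          calc _ ≤ (|(k.1 : ℝ)|⁻¹ * (|(k.2 : ℝ)|⁻¹ * |(k.2 : ℝ)|⁻¹)) * |(k.1 : ℝ)|⁻¹ := by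
                gcongr
            _ = _ := by ring
  have key := hasSum_integral_of_summable_integral_norm hi hs
  convert! key using 1
  · funext k
    by_cases hm : k.1 = 0
    · simp [hm, oddInv_zero, doubleSine]
    by_cases hn : k.2 = 0
    · simp [hn, oddInv_zero, doubleSine, greenSeries]
    have hm' : 0 < |(k.1 : ℝ)| := by simpa using hm
    have hn' : 0 < |(k.2 : ℝ)| := by simpa using hn
    have e : |(k.2 : ℝ)| = (k.2.natAbs : ℝ) := by rw [Nat.cast_natAbs]; simp
    have e1 : |(k.2 : ℝ)| * T = (k.2.natAbs * N : ℕ) * (2 * Real.pi) := by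
      rw [e, hT]; push_cast; ring
    have h := integral_exp_neg_mul_sin (μ := |(k.1 : ℝ)|) (ν := |(k.2 : ℝ)|) (T := T) hm'
      (by rw [e1]; simpa using Real.sin_add_nat_mul_two_pi 0 (k.2.natAbs * N))
      (by rw [e1]; exact Real.cos_nat_mul_two_pi _)
    rw [← intervalIntegral.integral_of_le hT0]
    have : ∀ s, oddInv k.1 * Real.sin (k.1 * X) * Real.exp (-|(k.1 : ℝ)| * s)
        * greenSeries Y s k.2 = (oddInv k.1 * Real.sin (k.1 * X) * (oddInv k.2
          * Real.sin (k.2 * Y)) / |(k.2 : ℝ)|) * (Real.exp (-|(k.1 : ℝ)| * s)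
          * Real.sin (|(k.2 : ℝ)| * s)) := by
      intro s; unfold greenSeries; ring
    simp_rw [this]
    rw [intervalIntegral.integral_const_mul, h, doubleSine, sq_abs, sq_abs]
    field_simp
  · rw [intervalIntegral.integral_of_le hT0]
    refine setIntegral_congr_fun measurableSet_Ioc (fun s hs => ?_)
    have hA := hasSum_arctan_sin_div_sinh X hs.1
    have hG := (summable_greenSeries Y s)
    have := (hA.mul hG.hasSum (summable_mul_of_summable_norm hA.summable.norm hG.norm)).tsum_eq
    simpa [squareWaveExt, green] using this.symm

/-! ### Logarithmic lower bound for the double sine series -/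

lemma arctan_le_self {v : ℝ} (hv : 0 ≤ v) : Real.arctan v ≤ v := by
  have h := Real.le_tan (Real.arctan_nonneg.2 hv) (Real.arctan_lt_pi_div_two v)
  rwa [Real.tan_arctan] at h

/-- This is sin 2θ ≤ 2θ at θ = arctan v. -/
lemma div_one_add_sq_le_arctan {v : ℝ} (hv : 0 ≤ v) : v / (1 + v ^ 2) ≤ Real.arctan v := by
  have h := Real.sin_le (x := 2 * Real.arctan v) (by have := Real.arctan_nonneg.2 hv; positivity)
  rw [Real.sin_two_mul, Real.sin_arctan, Real.cos_arctan] at h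
  have hs : √(1 + v ^ 2) * √(1 + v ^ 2) = 1 + v ^ 2 := Real.mul_self_sqrt (by positivity)
  have : 2 * (v / √(1 + v ^ 2)) * (1 / √(1 + v ^ 2)) = 2 * (v / (1 + v ^ 2)) := by
    rw [mul_assoc, div_mul_div_comm, hs, mul_one]
  linarith

lemma ten_mul_sinh_le {s : ℝ} (hs : 0 ≤ s) : 10 * Real.sinh s ≤ Real.sinh (s + Real.pi) := by
  have h0 : 0 ≤ Real.sinh s := Real.sinh_nonneg_iff.2 hs
  have h1 : Real.sinh s ≤ Real.cosh s := (Real.sinh_lt_cosh s).le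
  have h2 : 0 ≤ Real.sinh Real.pi := Real.sinh_nonneg_iff.2 Real.pi_pos.le
  have h3 : 10 ≤ Real.cosh Real.pi + Real.sinh Real.pi := by
    rw [Real.cosh_add_sinh]
    have e1 : Real.exp 3 ≤ Real.exp Real.pi := Real.exp_le_exp.2 Real.pi_gt_three.le
    have e2 : Real.exp 3 = Real.exp 1 ^ 3 := by rw [← Real.exp_nat_mul]; norm_num
    have e3 : (2.7 : ℝ) ^ 3 ≤ Real.exp 1 ^ 3 := by
      have := Real.exp_one_gt_d9
      gcongr
      linarith
    norm_num at e3
    linarith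
  rw [Real.sinh_add]
  nlinarith [mul_le_mul_of_nonneg_right h1 h2]

/-- With v = sin X / sinh s ≤ 2 the first term is at least v/(1+v²) ≥ v/5. A shift by π multiplies
sinh by at least 10, so the second is at most v/10. -/
lemma squareWaveExt_sub_ge {X s : ℝ} (hX : 0 ≤ Real.sin X) (hs : 0 < s)
    (h : Real.sin X / Real.sinh s ≤ 2) :
    Real.sin X / Real.sinh s / 10 ≤ squareWaveExt X s - squareWaveExt X (s + Real.pi) := by
  have hsinh : 0 < Real.sinh s := Real.sinh_pos_iff.2 hs
  set v := Real.sin X / Real.sinh s with hv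
  have hv0 : 0 ≤ v := by positivity
  have h1 : v / 5 ≤ Real.arctan v := by
    refine le_trans ?_ (div_one_add_sq_le_arctan hv0)
    gcongr
    nlinarith
  have h2 : Real.arctan (Real.sin X / Real.sinh (s + Real.pi)) ≤ v / 10 := by
    refine (arctan_le_self ?_).trans ?_
    · have := Real.sinh_nonneg_iff.2 (by positivity : 0 ≤ s + Real.pi)
      positivity
    · rw [hv, div_div]
      have := ten_mul_sinh_le hs.le
      gcongr
      linarith
  unfold squareWaveExt
  linarith

lemma squareWaveExt_antitone {X s t : ℝ} (hX : 0 ≤ Real.sin X) (hs : 0 < s) (hst : s ≤ t) :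
    squareWaveExt X t ≤ squareWaveExt X s := by
  unfold squareWaveExt
  have : 0 < Real.sinh s := Real.sinh_pos_iff.2 hs
  apply Real.arctan_mono
  gcongr
  exact Real.sinh_le_sinh.2 hst

lemma green_nonneg {Y s : ℝ} (hY : 0 ≤ Y) (hY' : Y ≤ Real.pi) (hs : 0 ≤ s)
    (hs' : s ≤ Real.pi) : 0 ≤ green Y s := by
  unfold green
  have := Real.pi_pos
  rcases le_total (Y + s) Real.pi with h | h
  · rw [(hasSum_greenSeries_of_le hY hs h).tsum_eq]
    positivity
  · rw [(hasSum_greenSeries_of_ge hY' hs' h).tsum_eq]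
    have : max Y s ≤ Real.pi := max_le hY' hs'
    exact mul_nonneg (by positivity) (by linarith)

lemma intervalIntegrable_squareWaveExt_mul {G : ℝ → ℝ} (hG : Continuous G) (X c a b : ℝ) :
    IntervalIntegrable (fun s => squareWaveExt X (s + c) * G s) volume a b := by
  have hm : Measurable fun s => squareWaveExt X (s + c) := by
    unfold squareWaveExt
    have : Measurable fun s : ℝ => Real.sinh (s + c) :=
      (Real.continuous_sinh.comp (continuous_id.add continuous_const)).measurable
    exact Real.continuous_arctan.measurable.comp (measurable_const.div this)
  rw [intervalIntegrable_iff]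
  refine Integrable.bdd_mul (c := Real.pi / 2) (intervalIntegrable_iff.1 (hG.intervalIntegrable a b))
    hm.aestronglyMeasurable (Filter.Eventually.of_forall fun s => ?_)
  rw [Real.norm_eq_abs, abs_le]
  exact ⟨(Real.neg_pi_div_two_lt_arctan _).le, (Real.arctan_lt_pi_div_two _).le⟩

/-- The period added is cut into halves of length π, on which `green` takes opposite values. -/
lemma integral_squareWaveExt_mul_green_step (X Y : ℝ) (N : ℕ) :
    ∫ s in (0 : ℝ)..(2 * Real.pi * (N + 1 : ℕ)), squareWaveExt X s * green Y s
      = (∫ s in (0 : ℝ)..(2 * Real.pi * N), squareWaveExt X s * green Y s)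
        + ∫ s in (0 : ℝ)..Real.pi, (squareWaveExt X (s + 2 * Real.pi * N)
          - squareWaveExt X (s + 2 * Real.pi * N + Real.pi)) * green Y s := by
  have hi : ∀ a b, IntervalIntegrable (fun s => squareWaveExt X s * green Y s) volume a b := by
    intro a b
    simpa using intervalIntegrable_squareWaveExt_mul (continuous_green Y) X 0 a b
  have hp := green_antiperiodic Y
  have h1 : ∀ s, green Y (s + 2 * Real.pi * N) = green Y s := by
    intro s
    have := hp.periodic_two_mul.nat_mul N s
    rw [← this]; congr 1; ring
  have e1 : ∫ s in (2 * Real.pi * N)..(2 * Real.pi * N + Real.pi), squareWaveExt X s * green Y s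
      = ∫ s in (0 : ℝ)..Real.pi, squareWaveExt X (s + 2 * Real.pi * N) * green Y s := by
    have := intervalIntegral.integral_comp_add_right (a := 0) (b := Real.pi)
      (fun s => squareWaveExt X s * green Y s) (2 * Real.pi * N)
    simp only [h1] at this
    rw [this, zero_add, add_comm Real.pi]
  have e2 : ∫ s in (2 * Real.pi * N + Real.pi)..(2 * Real.pi * (N + 1 : ℕ)),
      squareWaveExt X s * green Y s
      = -∫ s in (0 : ℝ)..Real.pi, squareWaveExt X (s + 2 * Real.pi * N + Real.pi) * green Y s := by
    have := intervalIntegral.integral_comp_add_right (a := 0) (b := Real.pi)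
      (fun s => squareWaveExt X s * green Y s) (2 * Real.pi * N + Real.pi)
    simp only [← add_assoc, hp (_ + _), h1, mul_neg, intervalIntegral.integral_neg] at this
    rw [this]
    congr 1
    · ring
    · push_cast; ring
  rw [← intervalIntegral.integral_add_adjacent_intervals (hi 0 (2 * Real.pi * N)) (hi _ _),
    ← intervalIntegral.integral_add_adjacent_intervals
      (hi (2 * Real.pi * N) (2 * Real.pi * N + Real.pi)) (hi _ _), e1, e2, ← sub_eq_add_neg,
    ← intervalIntegral.integral_sub]
  · simp only [sub_mul]
  · exact intervalIntegrable_squareWaveExt_mul (continuous_green Y) X _ _ _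
  · simp_rw [add_assoc]
    exact intervalIntegrable_squareWaveExt_mul (continuous_green Y) X _ _ _

/-- Each later period contributes a nonnegative amount, as the extension decreases in s and `green`
is nonnegative on [0, π]. Only the first is kept. -/
lemma integral_squareWaveExt_mul_green_ge {X Y : ℝ} (hX : 0 ≤ Real.sin X) (hY : 0 ≤ Y)
    (hY' : Y ≤ Real.pi) (N : ℕ) :
    ∫ s in (0 : ℝ)..Real.pi, (squareWaveExt X s - squareWaveExt X (s + Real.pi)) * green Y s
      ≤ ∫ s in (0 : ℝ)..(2 * Real.pi * (N + 1 : ℕ)), squareWaveExt X s * green Y s := by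
  have hp := Real.pi_pos
  induction N with
  | zero => rw [integral_squareWaveExt_mul_green_step]; simp
  | succ N ih =>
    rw [integral_squareWaveExt_mul_green_step]
    refine ih.trans (le_add_of_nonneg_right ?_)
    rw [intervalIntegral.integral_of_le hp.le]
    refine setIntegral_nonneg measurableSet_Ioc (fun s hs => ?_)
    have h0 : 0 < s + 2 * Real.pi * (N + 1 : ℕ) := by have := hs.1; positivity
    exact mul_nonneg (sub_nonneg.2 (squareWaveExt_antitone hX h0 (by linarith)))
      (green_nonneg hY hY' hs.1.le hs.2)

lemma sinh_le_mul {s : ℝ} (h0 : 0 ≤ s) (h2 : s ≤ 2) : Real.sinh s ≤ 8 * s := by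
  have e1 : Real.exp s ≤ 8 := by
    have e2 : Real.exp 2 = Real.exp 1 ^ 2 := by rw [← Real.exp_nat_mul]; norm_num
    have e3 : Real.exp 1 ^ 2 ≤ (2.8 : ℝ) ^ 2 := by
      have := Real.exp_one_lt_d9
      gcongr
      linarith
    have := Real.exp_le_exp.2 h2
    norm_num at e3
    linarith
  have h3 := Real.add_one_le_exp (-(2 * s))
  have h4 : Real.sinh s = Real.exp s * (1 - Real.exp (-(2 * s))) / 2 := by
    rw [Real.sinh_eq, mul_sub, ← Real.exp_add, show s + -(2 * s) = -s by ring, mul_one]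
  rw [h4]
  have h5 : Real.exp s * (1 - Real.exp (-(2 * s))) ≤ 8 * (2 * s) := by
    have : 0 < Real.exp s := Real.exp_pos s
    calc _ ≤ Real.exp s * (2 * s) := by gcongr; linarith
      _ ≤ _ := by gcongr
  linarith

lemma integral_squareWaveExt_sub_mul_green_ge {X Y : ℝ} (hX : 0 < X) (hX' : X ≤ Real.pi / 2)
    (hY : 0 < Y) (hY' : Y ≤ Real.pi / 2) :
    X * Y * Real.log (Real.pi / max X Y) / 160 ≤
      ∫ s in (0 : ℝ)..Real.pi, (squareWaveExt X s - squareWaveExt X (s + Real.pi)) * green Y s := by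
  have hp := Real.pi_pos
  have hp4 := Real.pi_lt_four
  have hsin : 0 ≤ Real.sin X := Real.sin_nonneg_of_nonneg_of_le_pi hX.le (by linarith)
  have hM : 0 < max X Y := lt_max_of_lt_left hX
  have hM' : max X Y ≤ Real.pi / 2 := max_le hX' hY'
  have hi : ∀ a b, IntervalIntegrable
      (fun s => (squareWaveExt X s - squareWaveExt X (s + Real.pi)) * green Y s) volume a b := by
    intro a b
    simp only [sub_mul]
    exact IntervalIntegrable.sub
      (by simpa using intervalIntegrable_squareWaveExt_mul (continuous_green Y) X 0 a b)
      (intervalIntegrable_squareWaveExt_mul (continuous_green Y) X _ a b)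
  have hpos : ∀ s, 0 < s → s ≤ Real.pi →
      0 ≤ (squareWaveExt X s - squareWaveExt X (s + Real.pi)) * green Y s := fun s h0 h1 =>
    mul_nonneg (sub_nonneg.2 (squareWaveExt_antitone hsin h0 (by linarith)))
      (green_nonneg hY.le (by linarith) h0.le h1)
  have h1 : ∫ s in (max X Y / 2)..(Real.pi / 2), X * Y / 160 * (1 / s)
      = X * Y * Real.log (Real.pi / max X Y) / 160 := by
    rw [intervalIntegral.integral_const_mul, integral_one_div_of_pos (by positivity) (by positivity)]
    have : Real.pi / 2 / (max X Y / 2) = Real.pi / max X Y := by field_simp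
    rw [this]; ring
  rw [← h1]
  -- On this range s ≥ max(X,Y)/2 gives sin X / sinh s ≤ 2 and min(Y,s) ≥ Y/2, while s ≤ π/2 keeps Y
  -- + s ≤ π, where `green` is the tent.
  calc _ ≤ ∫ s in (max X Y / 2)..(Real.pi / 2),
        (squareWaveExt X s - squareWaveExt X (s + Real.pi)) * green Y s := by
        refine intervalIntegral.integral_mono_on (by linarith) ?_ (hi _ _) (fun s hs => ?_)
        · refine ContinuousOn.intervalIntegrable ?_
          rw [uIcc_of_le (by linarith)]
          refine continuousOn_const.mul (continuousOn_const.div continuousOn_id fun s hs => ?_)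
          have := hs.1
          exact (lt_of_lt_of_le (by positivity) this).ne'
        · have hs0 : 0 < s := lt_of_lt_of_le (by positivity) hs.1
          have hsX : X ≤ 2 * s := by have := le_max_left X Y; linarith [hs.1]
          have hsY : Y ≤ 2 * s := by have := le_max_right X Y; linarith [hs.1]
          have hsinh : s ≤ Real.sinh s := Real.self_le_sinh_iff.2 hs0.le
          have hsinh' : Real.sinh s ≤ 8 * s := sinh_le_mul hs0.le (by linarith [hs.2])
          have a1 := squareWaveExt_sub_ge hsin hs0 (by
            rw [div_le_iff₀ (by linarith)]
            have := Real.sin_le hX.le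
            linarith)
          have a2 : 2 / Real.pi * X ≤ Real.sin X := Real.mul_le_sin hX.le hX'
          have a3 : Real.pi / 4 * Y ≤ green Y s := by
            unfold green
            rw [(hasSum_greenSeries_of_le hY.le hs0.le (by linarith [hs.2])).tsum_eq]
            have : Y / 2 ≤ min Y s := le_min (by linarith) (by linarith)
            calc Real.pi / 4 * Y = Real.pi / 2 * (Y / 2) := by ring
              _ ≤ _ := by gcongr
          calc X * Y / 160 * (1 / s) = (2 / Real.pi * X / (8 * s) / 10) * (Real.pi / 4 * Y) := by
                field_simp; norm_num
            _ ≤ (Real.sin X / Real.sinh s / 10) * (Real.pi / 4 * Y) := by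
                have : 0 < Real.sinh s := by linarith
                gcongr
            _ ≤ _ := by
                have : 0 ≤ Real.sin X / Real.sinh s / 10 := by
                  have : 0 < Real.sinh s := by linarith
                  positivity
                gcongr
                linarith
    _ ≤ _ := by
        refine intervalIntegral.integral_mono_interval (by positivity) (by linarith) (by linarith)
          ?_ (hi _ _)
        filter_upwards [ae_restrict_mem measurableSet_Ioc] with s hs
        exact hpos s hs.1 hs.2

/-- The stream function of the Bahouri-Chemin patch is log-Lipschitz from below. -/
lemma tsum_doubleSine_ge {X Y : ℝ} (hX : 0 < X) (hX' : X ≤ Real.pi / 2)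
    (hY : 0 < Y) (hY' : Y ≤ Real.pi / 2) :
    X * Y * Real.log (Real.pi / max X Y) / 160 ≤ ∑' k, doubleSine X Y k := by
  have hp := Real.pi_pos
  -- The limit is taken in the series, dominated by its own terms, so no integral over the half-line
  -- is needed.
  have hlim : Filter.Tendsto (fun N : ℕ => ∑' k : ℤ × ℤ,
      doubleSine X Y k * (1 - Real.exp (-|(k.1 : ℝ)| * (2 * Real.pi * (N + 1 : ℕ)))))
      Filter.atTop (nhds (∑' k, doubleSine X Y k)) := by
    refine tendsto_tsum_of_dominated_convergence (summable_doubleSine X Y).norm (fun k => ?_)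
      (Filter.Eventually.of_forall fun N k => ?_)
    · by_cases hm : k.1 = 0
      · simp [hm, doubleSine, oddInv_zero]
      have hm' : 0 < |(k.1 : ℝ)| := by simpa using hm
      have h1 : Filter.Tendsto (fun N : ℕ => Real.exp (-|(k.1 : ℝ)| * (2 * Real.pi * (N + 1 : ℕ))))
          Filter.atTop (nhds 0) := by
        refine Real.tendsto_exp_atBot.comp ?_
        refine Filter.Tendsto.const_mul_atTop_of_neg (by linarith) ?_
        refine Filter.Tendsto.const_mul_atTop (by positivity) ?_
        exact tendsto_natCast_atTop_atTop.comp (Filter.tendsto_add_atTop_nat 1)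
      simpa using (h1.const_sub 1).const_mul (doubleSine X Y k)
    · rw [norm_mul]
      refine mul_le_of_le_one_right (norm_nonneg _) ?_
      have h1 : Real.exp (-|(k.1 : ℝ)| * (2 * Real.pi * (N + 1 : ℕ))) ≤ 1 := by
        rw [Real.exp_le_one_iff]
        have : 0 ≤ |(k.1 : ℝ)| * (2 * Real.pi * (N + 1 : ℕ)) := by positivity
        linarith
      rw [Real.norm_eq_abs, abs_of_nonneg (by linarith)]
      linarith [Real.exp_pos (-|(k.1 : ℝ)| * (2 * Real.pi * (N + 1 : ℕ)))]
  refine ge_of_tendsto' hlim (fun N => ?_)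
  rw [(hasSum_integral_squareWaveExt_mul_green X Y (N + 1)).tsum_eq]
  exact (integral_squareWaveExt_sub_mul_green_ge hX hX' hY hY').trans
    (integral_squareWaveExt_mul_green_ge
      (Real.sin_nonneg_of_nonneg_of_le_pi hX.le (by linarith)) hY.le (by linarith) N)

/-! ### Fourier series and symmetries of ψ₀ -/

/-- The measurable identification of pairs of reals with the plane. -/
def planeEquiv : ℝ × ℝ ≃ᵐ Plane :=
  MeasurableEquiv.finTwoArrow.symm.trans (MeasurableEquiv.toLp 2 (Fin 2 → ℝ))

lemma planeEquiv_apply (p : ℝ × ℝ) : planeEquiv p = !₂[p.1, p.2] := rfl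

lemma measurePreserving_planeEquiv : MeasurePreserving planeEquiv :=
  (PiLp.volume_preserving_toLp (Fin 2)).comp (volume_preserving_finTwoArrow ℝ).symm

/-- A period of the circle. -/
abbrev period : Set ℝ := Ioc (-(1 / 2)) (1 / 2)

lemma planeEquiv_preimage_cell : planeEquiv ⁻¹' cell = period ×ˢ period := by
  ext p
  simp [cell, planeEquiv_apply, Fin.forall_fin_two]

lemma setIntegral_cell {E : Type*} [NormedAddCommGroup E] [NormedSpace ℝ E] (f : Plane → E) :
    ∫ z in cell, f z = ∫ p in period ×ˢ period, f !₂[p.1, p.2] := by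
  rw [← planeEquiv_preimage_cell,
    ← measurePreserving_planeEquiv.setIntegral_preimage_emb planeEquiv.measurableEmbedding]
  rfl

lemma integral_sgn_mul_exp (k : ℤ) :
    ∫ x in period, (sgn x : ℂ) * Complex.exp (2 * Real.pi * Complex.I * ((-k : ℤ) * x))
      = -(2 * Complex.I / Real.pi) * (oddInv k : ℝ) := by
  have hπ : (Real.pi : ℂ) ≠ 0 := by exact_mod_cast Real.pi_ne_zero
  set c : ℂ := -(2 * Real.pi * k * Complex.I) with hc
  have he : ∀ x : ℝ, Complex.exp (2 * Real.pi * Complex.I * ((-k : ℤ) * x))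
      = Complex.exp (c * x) := by
    intro x; congr 1; rw [hc]; push_cast; ring
  simp_rw [he]
  have hcont : Continuous fun x : ℝ => Complex.exp (c * x) := by fun_prop
  have h1 : EqOn (fun x : ℝ => (sgn x : ℂ) * Complex.exp (c * x))
      (fun x => -Complex.exp (c * x)) (Ioc (-(1 / 2)) 0) := by
    intro x hx
    simp [sgn, not_lt.2 hx.2]
  have h2 : EqOn (fun x : ℝ => (sgn x : ℂ) * Complex.exp (c * x))
      (fun x => Complex.exp (c * x)) (Ioc 0 (1 / 2)) := by
    intro x hx
    simp [sgn, hx.1]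
  have hu : Ioc (-(1 / 2) : ℝ) (1 / 2) = Ioc (-(1 / 2)) 0 ∪ Ioc 0 (1 / 2) :=
    (Ioc_union_Ioc_eq_Ioc (by norm_num) (by norm_num)).symm
  rw [period, hu, setIntegral_union (by simp [Set.disjoint_left]; intros; linarith)
    measurableSet_Ioc, setIntegral_congr_fun measurableSet_Ioc h1,
    setIntegral_congr_fun measurableSet_Ioc h2, integral_neg,
    ← intervalIntegral.integral_of_le (by norm_num),
    ← intervalIntegral.integral_of_le (by norm_num)]
  rotate_left
  · exact (integrableOn_congr_fun h1 measurableSet_Ioc).2 (hcont.neg.intervalIntegrable _ _).1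
  · exact (integrableOn_congr_fun h2 measurableSet_Ioc).2 (hcont.intervalIntegrable _ _).1
  by_cases hk : k = 0
  · subst hk
    simp [hc, oddInv_zero]
  have hk' : (k : ℂ) ≠ 0 := by exact_mod_cast hk
  have hc0 : c ≠ 0 := by
    rw [hc]; simp [hπ, hk', Complex.I_ne_zero]
  have hE : Complex.exp (Real.pi * Complex.I * k) = (-1) ^ k := by
    rw [mul_comm, Complex.exp_int_mul, Complex.exp_pi_mul_I]
  have e1 : Complex.exp (c * ((-(1 / 2) : ℝ) : ℂ)) = (-1) ^ k := by
    rw [← hE]; congr 1; rw [hc]; push_cast; ring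
  have e2 : Complex.exp (c * ((1 / 2 : ℝ) : ℂ)) = (-1) ^ k := by
    have : c * ((1 / 2 : ℝ) : ℂ) = -(Real.pi * Complex.I * k) := by rw [hc]; push_cast; ring
    rw [this, Complex.exp_neg, hE]
    rcases Int.even_or_odd k with h | h
    · simp [h.neg_one_zpow]
    · simp [h.neg_one_zpow]
  rw [integral_exp_mul_complex hc0, integral_exp_mul_complex hc0, e1, e2]
  simp only [Complex.ofReal_zero, mul_zero, Complex.exp_zero]
  unfold oddInv
  rcases Int.even_or_odd k with h | h
  · rw [if_neg (Int.not_odd_iff_even.2 h), h.neg_one_zpow]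
    simp
  · rw [if_pos h, h.neg_one_zpow, hc]
    push_cast
    have hI := Complex.I_ne_zero
    field_simp
    rw [Complex.I_sq]
    ring

lemma fourierCoefficient_sgn_mul_sgn (k : ℤ × ℤ) :
    fourierCoefficient (fun z => sgn (z 0) * sgn (z 1)) k
      = -((4 / Real.pi ^ 2 * (oddInv k.1 * oddInv k.2) : ℝ) : ℂ) := by
  unfold fourierCoefficient
  rw [setIntegral_cell]
  have : ∀ p : ℝ × ℝ, (((fun z : Plane => sgn (z 0) * sgn (z 1)) !₂[p.1, p.2] : ℝ) : ℂ)
      * character (-k) !₂[p.1, p.2]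
      = ((sgn p.1 : ℂ) * Complex.exp (2 * Real.pi * Complex.I * ((-k.1 : ℤ) * p.1)))
        * ((sgn p.2 : ℂ) * Complex.exp (2 * Real.pi * Complex.I * ((-k.2 : ℤ) * p.2))) := by
    intro p
    unfold character
    rw [mul_add, Complex.exp_add]
    simp
    ring
  simp_rw [this]
  rw [Measure.volume_eq_prod, setIntegral_prod_mul (μ := volume) (ν := volume)
    (fun x : ℝ => (sgn x : ℂ) * Complex.exp (2 * Real.pi * Complex.I * ((-k.1 : ℤ) * x)))
    (fun x : ℝ => (sgn x : ℂ) * Complex.exp (2 * Real.pi * Complex.I * ((-k.2 : ℤ) * x))),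
    integral_sgn_mul_exp, integral_sgn_mul_exp]
  push_cast
  have hπ : (Real.pi : ℂ) ≠ 0 := by exact_mod_cast Real.pi_ne_zero
  field_simp
  rw [Complex.I_sq]
  ring

/-- The sum of the double sine series. -/
def doubleSineSum (X Y : ℝ) : ℝ := ∑' k, doubleSine X Y k

lemma doubleSineSum_swap (X Y : ℝ) : doubleSineSum Y X = doubleSineSum X Y := by
  unfold doubleSineSum
  rw [← (Equiv.prodComm ℤ ℤ).tsum_eq]
  congr 1
  funext k
  simp only [doubleSine, Equiv.prodComm_apply, Prod.fst_swap, Prod.snd_swap]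
  rw [add_comm]; ring

lemma doubleSineSum_neg_left (X Y : ℝ) : doubleSineSum (-X) Y = -doubleSineSum X Y := by
  unfold doubleSineSum
  rw [← tsum_neg]
  congr 1
  funext k
  simp only [doubleSine, mul_neg, Real.sin_neg]
  ring

lemma doubleSineSum_add_pi_left (X Y : ℝ) :
    doubleSineSum (X + Real.pi) Y = -doubleSineSum X Y := by
  unfold doubleSineSum
  rw [← tsum_neg]
  congr 1
  funext k
  simp only [doubleSine]
  by_cases h1 : Odd k.1
  · rw [mul_add, Real.sin_add_int_mul_pi, h1.neg_one_zpow]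
    ring
  · simp [oddInv, h1]

lemma doubleSineSum_neg_right (X Y : ℝ) : doubleSineSum X (-Y) = -doubleSineSum X Y := by
  rw [doubleSineSum_swap, doubleSineSum_neg_left, doubleSineSum_swap]

lemma doubleSineSum_add_pi_right (X Y : ℝ) :
    doubleSineSum X (Y + Real.pi) = -doubleSineSum X Y := by
  rw [doubleSineSum_swap, doubleSineSum_add_pi_left, doubleSineSum_swap]

/-- The multiplier turns the coefficient -4/(π²mn) into 1/(π⁴mn(m²+n²)) for odd m, n. Of cos(mX +
nY) only -sin(mX) sin(nY) survives, since the cosine product is odd under m ↦ -m after weighting. -/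
lemma psi0_eq (z : Plane) :
    psi0 z = -(doubleSineSum (2 * Real.pi * z 0) (2 * Real.pi * z 1) / Real.pi ^ 4) := by
  set X := 2 * Real.pi * z 0
  set Y := 2 * Real.pi * z 1
  have hπ : (Real.pi : ℂ) ≠ 0 := by exact_mod_cast Real.pi_ne_zero
  set r : ℤ × ℤ → ℝ := fun k => oddInv k.1 * oddInv k.2 / ((k.1 : ℝ) ^ 2 + (k.2 : ℝ) ^ 2) with hr
  have hdc : ∀ k, r k * (Real.sin (k.1 * X) * Real.sin (k.2 * Y)) = doubleSine X Y k := by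
    intro k; simp only [hr, doubleSine]; ring
  have hterm : ∀ k : ℤ × ℤ, (if k = 0 then 0 else
      -(fourierCoefficient (fun z => sgn (z 0) * sgn (z 1)) k
        / (4 * (Real.pi : ℂ) ^ 2 * ((k.1 : ℂ) ^ 2 + (k.2 : ℂ) ^ 2))) * character k z)
      = ((r k / Real.pi ^ 4 : ℝ) : ℂ) * Complex.exp (((k.1 * X + k.2 * Y : ℝ) : ℂ) * Complex.I) := by
    intro k
    split_ifs with hk
    · simp [hr, hk, oddInv_zero]
    · rw [fourierCoefficient_sgn_mul_sgn]
      have : character k z = Complex.exp (((k.1 * X + k.2 * Y : ℝ) : ℂ) * Complex.I) := by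
        unfold character
        congr 1
        simp only [X, Y]
        push_cast
        ring
      rw [this]
      congr 1
      simp only [hr]
      push_cast
      simp only [div_eq_mul_inv, mul_inv]
      ring
  have hsum_r : Summable fun k => |r k| := by
    refine summable_int_prod_inv_sq.of_nonneg_of_le (fun k => abs_nonneg _) (fun k => ?_)
    by_cases hm : k.1 = 0
    · simp [hr, hm, oddInv_zero]
    by_cases hn : k.2 = 0
    · simp [hr, hn, oddInv_zero]
    have hm' : 0 < |(k.1 : ℝ)| := by simpa using hm
    have hn' : 0 < |(k.2 : ℝ)| := by simpa using hn
    have h5 : |(k.1 : ℝ)| * |(k.2 : ℝ)| ≤ |(k.1 : ℝ) ^ 2 + (k.2 : ℝ) ^ 2| := by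
      rw [abs_of_nonneg (by positivity : 0 ≤ (k.1 : ℝ) ^ 2 + (k.2 : ℝ) ^ 2)]
      nlinarith [sq_nonneg (|(k.1 : ℝ)| - |(k.2 : ℝ)|), sq_abs (k.1 : ℝ), sq_abs (k.2 : ℝ)]
    have h1 := abs_oddInv_le k.1
    have h2 := abs_oddInv_le k.2
    simp only [hr]
    rw [abs_div, abs_mul]
    calc _ ≤ (|(k.1 : ℝ)|⁻¹ * |(k.2 : ℝ)|⁻¹) / (|(k.1 : ℝ)| * |(k.2 : ℝ)|) := by gcongr
      _ = _ := by field_simp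
  have hsum : Summable fun k : ℤ × ℤ =>
      ((r k / Real.pi ^ 4 : ℝ) : ℂ) * Complex.exp (((k.1 * X + k.2 * Y : ℝ) : ℂ) * Complex.I) := by
    refine (hsum_r.div_const (Real.pi ^ 4)).of_norm_bounded (fun k => ?_)
    rw [norm_mul, Complex.norm_exp_ofReal_mul_I, mul_one, Complex.norm_real, Real.norm_eq_abs,
      abs_div, abs_of_pos (by positivity : 0 < Real.pi ^ 4)]
  have hcos : ∑' k : ℤ × ℤ, r k * (Real.cos (k.1 * X) * Real.cos (k.2 * Y)) = 0 := by
    have h := ((Equiv.neg ℤ).prodCongr (Equiv.refl ℤ)).tsum_eq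
      (fun k : ℤ × ℤ => r k * (Real.cos (k.1 * X) * Real.cos (k.2 * Y)))
    have h' : ∀ k : ℤ × ℤ, (fun k : ℤ × ℤ => r k * (Real.cos (k.1 * X) * Real.cos (k.2 * Y)))
        (((Equiv.neg ℤ).prodCongr (Equiv.refl ℤ)) k)
        = -(r k * (Real.cos (k.1 * X) * Real.cos (k.2 * Y))) := by
      intro k
      simp [hr, oddInv_neg]
      ring
    simp_rw [h'] at h
    rw [tsum_neg] at h
    linarith
  have hsc : Summable fun k : ℤ × ℤ => r k * (Real.cos (k.1 * X) * Real.cos (k.2 * Y)) := by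
    refine hsum_r.of_norm_bounded (fun k => ?_)
    rw [norm_mul, norm_mul, Real.norm_eq_abs]
    have h1 := Real.abs_cos_le_one (k.1 * X)
    have h2 := Real.abs_cos_le_one (k.2 * Y)
    calc _ ≤ |r k| * (1 * 1) := by gcongr <;> assumption
      _ = _ := by ring
  have hmain : psi0 z = ∑' k : ℤ × ℤ, (r k * (Real.cos (k.1 * X) * Real.cos (k.2 * Y))
      - doubleSine X Y k) / Real.pi ^ 4 := by
    unfold psi0 invLaplacian
    simp_rw [hterm]
    rw [Complex.re_tsum hsum]
    congr 1
    funext k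
    rw [Complex.re_ofReal_mul, Complex.exp_ofReal_mul_I_re, Real.cos_add, ← hdc]
    ring
  rw [hmain, tsum_div_const, hsc.tsum_sub (summable_doubleSine X Y), hcos, doubleSineSum]
  ring

lemma continuous_psi0 : Continuous psi0 := by
  have h : psi0 = fun z : Plane =>
      -((∑' k, doubleSine (2 * Real.pi * z 0) (2 * Real.pi * z 1) k) / Real.pi ^ 4) :=
    funext psi0_eq
  rw [h]
  refine ((continuous_tsum (fun k => ?_) summable_int_prod_inv_sq
    (fun k z => abs_doubleSine_le _ _ k)).div_const _).neg
  unfold doubleSine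
  fun_prop

lemma torusPeriodic_psi0 : TorusPeriodic psi0 := by
  intro x y
  have e : ∀ t : ℝ, 2 * Real.pi * (t + 1) = 2 * Real.pi * t + Real.pi + Real.pi := fun t => by ring
  constructor <;>
  simp [psi0_eq, e, doubleSineSum_add_pi_left, doubleSineSum_add_pi_right]

lemma oddOdd_psi0 : OddOdd psi0 := by
  intro x y
  constructor <;>
  simp [psi0_eq, mul_neg, doubleSineSum_neg_left, doubleSineSum_neg_right, neg_div]

/-! ### Lower bound for |ψ₀| by the distance to the grid -/

/-- The distance of a point of the period to the half-integers. -/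
def gridDist (x : ℝ) : ℝ := min |x| (1 / 2 - |x|)

lemma gridDist_le (x : ℝ) : gridDist x ≤ 1 / 4 := by
  unfold gridDist
  rcases le_total |x| (1 / 4) with h | h
  · exact (min_le_left _ _).trans h
  · exact (min_le_right _ _).trans (by linarith)

lemma gridDist_nonneg {x : ℝ} (hx : |x| ≤ 1 / 2) : 0 ≤ gridDist x :=
  le_min (abs_nonneg x) (by linarith)

/-- Reflections in 0 and in the quarter period change only the sign, which moves every point into
the quadrant of the lower bound. -/
lemma abs_doubleSineSum_gridDist_left (x Y : ℝ) :
    |doubleSineSum (2 * Real.pi * gridDist x) Y| = |doubleSineSum (2 * Real.pi * x) Y| := by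
  have habs : |doubleSineSum (2 * Real.pi * |x|) Y| = |doubleSineSum (2 * Real.pi * x) Y| := by
    rcases abs_choice x with h | h <;> simp [h, mul_neg, doubleSineSum_neg_left]
  rw [← habs]
  unfold gridDist
  rcases min_choice |x| (1 / 2 - |x|) with h | h
  · rw [h]
  · rw [h, show 2 * Real.pi * (1 / 2 - |x|) = -(2 * Real.pi * |x|) + Real.pi by ring,
      doubleSineSum_add_pi_left, doubleSineSum_neg_left, neg_neg]

lemma abs_psi0_ge {x y : ℝ} (hx : |x| ≤ 1 / 2) (hy : |y| ≤ 1 / 2) :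
    gridDist x * gridDist y * Real.log (1 / (2 * max (gridDist x) (gridDist y))) / 400
      ≤ |psi0 !₂[x, y]| := by
  have hp := Real.pi_pos
  have h : |psi0 !₂[x, y]|
      = |doubleSineSum (2 * Real.pi * gridDist x) (2 * Real.pi * gridDist y)| / Real.pi ^ 4 := by
    rw [psi0_eq, abs_neg, abs_div, abs_of_pos (by positivity : 0 < Real.pi ^ 4),
      abs_doubleSineSum_gridDist_left,
      doubleSineSum_swap (2 * Real.pi * gridDist y) (2 * Real.pi * x),
      abs_doubleSineSum_gridDist_left, doubleSineSum_swap]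
    rfl
  rcases (gridDist_nonneg hx).eq_or_lt with h0 | h0
  · rw [← h0]; simp
  rcases (gridDist_nonneg hy).eq_or_lt with h1 | h1
  · rw [← h1]; simp
  set a := gridDist x
  set b := gridDist y
  have ha : a ≤ 1 / 4 := gridDist_le x
  have hb : b ≤ 1 / 4 := gridDist_le y
  have key := tsum_doubleSine_ge (X := 2 * Real.pi * a) (Y := 2 * Real.pi * b) (by positivity)
    (by nlinarith) (by positivity) (by nlinarith)
  rw [← mul_max_of_nonneg _ _ (by positivity)] at key
  have hm : 0 < max a b := lt_max_of_lt_left h0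
  have e : Real.pi / (2 * Real.pi * max a b) = 1 / (2 * max a b) := by field_simp
  rw [e] at key
  have hlog : 0 ≤ Real.log (1 / (2 * max a b)) := by
    apply Real.log_nonneg
    rw [le_div_iff₀ (by positivity)]
    have : max a b ≤ 1 / 4 := max_le ha hb
    linarith
  rw [h, le_div_iff₀ (by positivity)]
  refine le_trans ?_ (key.trans (le_abs_self _))
  -- The constant is (2π)²/(160π⁴) = 1/(40π²) ≥ 1/400.
  have hp2 : Real.pi ^ 2 ≤ 10 := by nlinarith [Real.pi_lt_d2]
  have hq : 0 ≤ a * b * Real.log (1 / (2 * max a b)) * Real.pi ^ 2 := by positivity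
  nlinarith [mul_le_mul_of_nonneg_left hp2 hq]

/-! ### Calculus on the torus and Green's identity -/

/-- The standard unit vectors of the plane. -/
abbrev unitVec (i : Fin 2) : Plane := EuclideanSpace.single i 1

/-- The partial derivatives of a function on the plane. -/
def partialDeriv (i : Fin 2) (f : Plane → ℝ) (z : Plane) : ℝ := fderiv ℝ f z (unitVec i)

lemma TorusPeriodic.add_unitVec {f : Plane → ℝ} (hf : TorusPeriodic f) (i : Fin 2) (z : Plane) :
    f (z + unitVec i) = f z := by
  have hz : z = !₂[z 0, z 1] := by ext j; fin_cases j <;> rfl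
  have h := hf (z 0) (z 1)
  rw [← hz] at h
  fin_cases i
  · rw [← h.1]; congr 1; ext j; fin_cases j <;> simp
  · rw [← h.2]; congr 1; ext j; fin_cases j <;> simp

lemma torusPeriodic_of_add_unitVec {f : Plane → ℝ} (hf : ∀ i z, f (z + unitVec i) = f z) :
    TorusPeriodic f := by
  intro x y
  constructor
  · rw [← hf 0 !₂[x, y]]; congr 1; ext j; fin_cases j <;> simp
  · rw [← hf 1 !₂[x, y]]; congr 1; ext j; fin_cases j <;> simp

lemma torusPeriodic_partialDeriv {f : Plane → ℝ} (hf : TorusPeriodic f) (i : Fin 2) :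
    TorusPeriodic (partialDeriv i f) := by
  refine torusPeriodic_of_add_unitVec fun j z => ?_
  unfold partialDeriv
  rw [← fderiv_comp_add_right]
  simp_rw [hf.add_unitVec j]

lemma TorusPeriodic.mul {f g : Plane → ℝ} (hf : TorusPeriodic f) (hg : TorusPeriodic g) :
    TorusPeriodic (f * g) := fun x y => by simp [hf x y, hg x y]

lemma hasDerivAt_pair_left (x y : ℝ) :
    HasDerivAt (fun s : ℝ => (!₂[s, y] : Plane)) (unitVec 0) x := by
  have e : (fun s : ℝ => (!₂[s, y] : Plane)) = fun s : ℝ => s • unitVec 0 + !₂[0, y] := by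
    funext s; ext j; fin_cases j <;> simp
  rw [e]
  simpa using ((hasDerivAt_id x).smul_const (unitVec 0)).add_const (!₂[0, y] : Plane)

lemma hasDerivAt_pair_right (x y : ℝ) :
    HasDerivAt (fun s : ℝ => (!₂[x, s] : Plane)) (unitVec 1) y := by
  have e : (fun s : ℝ => (!₂[x, s] : Plane)) = fun s : ℝ => s • unitVec 1 + !₂[x, 0] := by
    funext s; ext j; fin_cases j <;> simp
  rw [e]
  simpa using ((hasDerivAt_id y).smul_const (unitVec 1)).add_const (!₂[x, 0] : Plane)

lemma hasDerivAt_left {f : Plane → ℝ} (hf : ContDiff ℝ 1 f) (x y : ℝ) :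
    HasDerivAt (fun s : ℝ => f !₂[s, y]) (partialDeriv 0 f !₂[x, y]) x :=
  ((hf.differentiable one_ne_zero).differentiableAt.hasFDerivAt).comp_hasDerivAt x
    (hasDerivAt_pair_left x y)

lemma hasDerivAt_right {f : Plane → ℝ} (hf : ContDiff ℝ 1 f) (x y : ℝ) :
    HasDerivAt (fun s : ℝ => f !₂[x, s]) (partialDeriv 1 f !₂[x, y]) y :=
  ((hf.differentiable one_ne_zero).differentiableAt.hasFDerivAt).comp_hasDerivAt y
    (hasDerivAt_pair_right x y)

lemma continuous_partialDeriv {f : Plane → ℝ} (hf : ContDiff ℝ 1 f) (i : Fin 2) :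
    Continuous (partialDeriv i f) :=
  (hf.continuous_fderiv one_ne_zero).clm_apply continuous_const

lemma continuous_pair : Continuous fun p : ℝ × ℝ => (!₂[p.1, p.2] : Plane) := by
  fun_prop

lemma integrableOn_period_prod {E : Type*} [NormedAddCommGroup E] {f : ℝ × ℝ → E}
    (hf : Continuous f) : IntegrableOn f (period ×ˢ period) :=
  (hf.continuousOn.integrableOn_compact (isCompact_Icc.prod isCompact_Icc)).mono_set
    (Set.prod_mono Ioc_subset_Icc_self Ioc_subset_Icc_self)

lemma integrableOn_cell {E : Type*} [NormedAddCommGroup E] {f : Plane → E}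
    (hf : Continuous f) : IntegrableOn f cell := by
  rw [← measurePreserving_planeEquiv.integrableOn_comp_preimage planeEquiv.measurableEmbedding,
    planeEquiv_preimage_cell]
  exact integrableOn_period_prod (hf.comp continuous_pair)

lemma measurableSet_cell : MeasurableSet cell := by
  rw [← planeEquiv.measurableSet_preimage, planeEquiv_preimage_cell]
  exact measurableSet_Ioc.prod measurableSet_Ioc

lemma setIntegral_period_prod_symm {E : Type*} [NormedAddCommGroup E] [NormedSpace ℝ E]
    {f : ℝ × ℝ → E} (hf : IntegrableOn f (period ×ˢ period)) :
    ∫ p in period ×ˢ period, f p = ∫ y in period, ∫ x in period, f (x, y) := by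
  rw [Measure.volume_eq_prod, ← Measure.prod_restrict, integral_prod_symm]
  rwa [IntegrableOn, Measure.volume_eq_prod, ← Measure.prod_restrict] at hf

lemma integral_period_deriv {u u' : ℝ → ℝ} (hu : ∀ x, HasDerivAt u (u' x) x)
    (hu' : Continuous u') (h : u (1 / 2) = u (-(1 / 2))) : ∫ x in period, u' x = 0 := by
  rw [period, ← intervalIntegral.integral_of_le (by norm_num),
    intervalIntegral.integral_eq_sub_of_hasDerivAt (fun x _ => hu x)
      (hu'.intervalIntegrable _ _), h, sub_self]

lemma integral_cell_partialDeriv {f : Plane → ℝ} (hf : ContDiff ℝ 1 f) (hp : TorusPeriodic f)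
    (i : Fin 2) : ∫ z in cell, partialDeriv i f z = 0 := by
  rw [setIntegral_cell]
  have hc := (continuous_partialDeriv hf i).comp continuous_pair
  have hi := integrableOn_period_prod hc
  simp only [Function.comp_def] at hi hc
  fin_cases i
  · rw [setIntegral_period_prod_symm hi]
    refine integral_eq_zero_of_ae (Filter.Eventually.of_forall fun y => ?_)
    refine integral_period_deriv (fun x => hasDerivAt_left hf x y)
      (hc.comp (by fun_prop : Continuous fun x : ℝ => (x, y))) ?_
    have := (hp (-(1 / 2)) y).1
    norm_num at this ⊢
    exact this
  · rw [Measure.volume_eq_prod] at hi ⊢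
    rw [setIntegral_prod _ hi]
    refine integral_eq_zero_of_ae (Filter.Eventually.of_forall fun x => ?_)
    refine integral_period_deriv (fun y => hasDerivAt_right hf x y)
      (hc.comp (by fun_prop : Continuous fun y : ℝ => (x, y))) ?_
    have := (hp x (-(1 / 2))).2
    norm_num at this ⊢
    exact this

lemma laplacian_eq_sum_partialDeriv {φ : Plane → ℝ} (hφ : ContDiff ℝ ∞ φ) (z : Plane) :
    Laplacian.laplacian φ z = ∑ i, partialDeriv i (partialDeriv i φ) z := by
  rw [InnerProductSpace.laplacian_eq_iteratedFDeriv_orthonormalBasis φ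
    (EuclideanSpace.basisFun (Fin 2) ℝ)]
  refine Finset.sum_congr rfl fun i _ => ?_
  rw [iteratedFDeriv_two_apply, EuclideanSpace.basisFun_apply]
  unfold partialDeriv
  rw [fderiv_clm_apply]
  · simp
  · exact (hφ.fderiv_right (m := 1) (by norm_cast)).differentiable one_ne_zero z
  · exact differentiableAt_const _

lemma contDiff_partialDeriv {φ : Plane → ℝ} (hφ : ContDiff ℝ ∞ φ) (i : Fin 2) :
    ContDiff ℝ ∞ (partialDeriv i φ) :=
  (hφ.fderiv_right (m := ∞) (by norm_cast)).clm_apply contDiff_const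

/-- Green's identity on the torus. -/
lemma integral_cell_mul_laplacian {w φ : Plane → ℝ} (hw : ContDiff ℝ 1 w) (hwp : TorusPeriodic w)
    (hφ : ContDiff ℝ ∞ φ) (hφp : TorusPeriodic φ) :
    ∫ z in cell, w z * Laplacian.laplacian φ z
      = -∫ z in cell, ∑ i, partialDeriv i w z * partialDeriv i φ z := by
  have hφi : ∀ i, ContDiff ℝ 1 (partialDeriv i φ) := fun i =>
    (contDiff_partialDeriv hφ i).of_le (by norm_cast)
  have hφ1 : ContDiff ℝ 1 φ := hφ.of_le (by norm_cast)
  have key : ∀ i, ∫ z in cell, (w z * partialDeriv i (partialDeriv i φ) z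
      + partialDeriv i w z * partialDeriv i φ z) = 0 := by
    intro i
    rw [← integral_cell_partialDeriv (hw.mul (hφi i))
      (hwp.mul (torusPeriodic_partialDeriv hφp i)) i]
    congr 1
    funext z
    have h1 : DifferentiableAt ℝ w z := hw.differentiable one_ne_zero z
    have h2 : DifferentiableAt ℝ (partialDeriv i φ) z := (hφi i).differentiable one_ne_zero z
    conv_rhs => unfold partialDeriv
    erw [fderiv_mul h1 h2]
    simp [partialDeriv]
    ring
  have hc1 : ∀ i, IntegrableOn (fun z => w z * partialDeriv i (partialDeriv i φ) z) cell :=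
    fun i => integrableOn_cell (hw.continuous.mul (continuous_partialDeriv (hφi i) i))
  have hc2 : ∀ i, IntegrableOn (fun z => partialDeriv i w z * partialDeriv i φ z) cell :=
    fun i => integrableOn_cell ((continuous_partialDeriv hw i).mul (continuous_partialDeriv hφ1 i))
  simp_rw [laplacian_eq_sum_partialDeriv hφ, Finset.mul_sum]
  rw [integral_finsetSum _ fun i _ => hc1 i, integral_finsetSum _ fun i _ => hc2 i,
    ← Finset.sum_neg_distrib]
  refine Finset.sum_congr rfl fun i _ => ?_
  have := key i
  rw [integral_add (hc1 i) (hc2 i)] at this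
  linarith

/-! ### Mollification and the energy identity -/

/-- A mollification kernel of radius tending to zero. -/
def bump (n : ℕ) : ContDiffBump (0 : Plane) where
  rIn := 1 / ((n : ℝ) + 1)
  rOut := 2 / ((n : ℝ) + 1)
  rIn_pos := by positivity
  rIn_lt_rOut := by gcongr; norm_num

lemma tendsto_bump_rOut :
    Filter.Tendsto (fun n => (bump n).rOut) Filter.atTop (nhds 0) := by
  have := (tendsto_one_div_add_atTop_nhds_zero_nat (𝕜 := ℝ)).const_mul 2
  simpa [bump, div_eq_mul_inv] using this

/-- The mollification of a function on the plane. -/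
def mollify {E : Type*} [NormedAddCommGroup E] [NormedSpace ℝ E] (n : ℕ) (f : Plane → E)
    (z : Plane) : E :=
  ∫ t, (bump n).normed volume t • f (z - t)

section mollify

variable {E : Type*} [NormedAddCommGroup E] [NormedSpace ℝ E]

lemma tendsto_mollify [CompleteSpace E] {f : Plane → E} (hf : Continuous f) (z : Plane) :
    Filter.Tendsto (fun n => mollify n f z) Filter.atTop (nhds (f z)) :=
  ContDiffBump.convolution_tendsto_right_of_continuous tendsto_bump_rOut hf z

lemma norm_mollify_le {f : Plane → E} {B : ℝ} (hB : ∀ z, ‖f z‖ ≤ B) (n : ℕ) (z : Plane) :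
    ‖mollify n f z‖ ≤ B := by
  have h := norm_integral_le_of_norm_le (μ := volume)
    (f := fun t => (bump n).normed volume t • f (z - t))
    (g := fun t => (bump n).normed volume t * B) ((bump n).integrable_normed.mul_const B)
    (Filter.Eventually.of_forall fun t => by
      rw [norm_smul, Real.norm_eq_abs, abs_of_nonneg ((bump n).nonneg_normed t)]
      exact mul_le_mul_of_nonneg_left (hB _) ((bump n).nonneg_normed t))
  rwa [integral_mul_const, (bump n).integral_normed, one_mul] at h

lemma contDiff_mollify [CompleteSpace E] {f : Plane → E} (hf : Continuous f) (n : ℕ) :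
    ContDiff ℝ ∞ (mollify n f) :=
  (bump n).hasCompactSupport_normed.contDiff_convolution_left (ContinuousLinearMap.lsmul ℝ ℝ)
    (bump n).contDiff_normed hf.locallyIntegrable

lemma integrable_mollify {f : Plane → E} (hf : Continuous f) (n : ℕ) (z : Plane) :
    Integrable (fun t => (bump n).normed volume t • f (z - t)) := by
  refine Continuous.integrable_of_hasCompactSupport ?_ ?_
  · exact (bump n).continuous_normed.smul (hf.comp (continuous_const.sub continuous_id))
  · exact (bump n).hasCompactSupport_normed.smul_right

end mollify

/-- The derivative is put on f rather than on the kernel, so that the gradients of the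
mollifications converge to that of f. -/
lemma hasFDerivAt_mollify {f : Plane → ℝ} (hf : ContDiff ℝ 1 f) {B : ℝ}
    (hB : ∀ z, ‖fderiv ℝ f z‖ ≤ B) (n : ℕ) (z : Plane) :
    HasFDerivAt (mollify n f) (mollify n (fderiv ℝ f) z) z := by
  have hc' := hf.continuous_fderiv one_ne_zero
  refine hasFDerivAt_integral_of_dominated_of_fderiv_le (𝕜 := ℝ)
    (F := fun z t => (bump n).normed volume t • f (z - t))
    (F' := fun z t => (bump n).normed volume t • fderiv ℝ f (z - t))
    (bound := fun t => (bump n).normed volume t * B) Filter.univ_mem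
    (Filter.Eventually.of_forall fun z => (integrable_mollify hf.continuous n z).1)
    (integrable_mollify hf.continuous n z) (integrable_mollify hc' n z).1
    (Filter.Eventually.of_forall fun t z _ => ?_) ((bump n).integrable_normed.mul_const B)
    (Filter.Eventually.of_forall fun t z _ => ?_)
  · rw [norm_smul, Real.norm_eq_abs, abs_of_nonneg ((bump n).nonneg_normed t)]
    exact mul_le_mul_of_nonneg_left (hB _) ((bump n).nonneg_normed t)
  · have h : HasFDerivAt (fun z => f (z - t)) (fderiv ℝ f (z - t)) z := by
      have h0 := (hf.differentiable one_ne_zero (z - t)).hasFDerivAt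
      simpa using! h0.comp z ((hasFDerivAt_id z).sub_const t)
    exact h.fun_const_smul _

lemma torusPeriodic_mollify {f : Plane → ℝ} (hf : TorusPeriodic f) (n : ℕ) :
    TorusPeriodic (mollify n f) := by
  refine torusPeriodic_of_add_unitVec fun i z => ?_
  unfold mollify
  simp_rw [add_sub_right_comm, hf.add_unitVec]

/-- The energy identity for a weak solution of `Δ w = g`. -/
lemma integral_cell_gradient_sq {w g : Plane → ℝ} (hw : ContDiff ℝ 1 w) (hwp : TorusPeriodic w)
    {B : ℝ} (hB : ∀ z, ‖w z‖ ≤ B) (hB' : ∀ z, ‖fderiv ℝ w z‖ ≤ B) (hg : Continuous g)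
    (h : ∀ φ : Plane → ℝ, ContDiff ℝ ∞ φ → TorusPeriodic φ →
      ∫ z in cell, w z * Laplacian.laplacian φ z = ∫ z in cell, g z * φ z) :
    ∫ z in cell, ∑ i, partialDeriv i w z ^ 2 = -∫ z in cell, g z * w z := by
  have hw' := hw.continuous_fderiv one_ne_zero
  -- As w is only C¹ it is not an admissible test function; its mollifications are, and the limit is
  -- taken by dominated convergence.
  have hn : ∀ n, ∫ z in cell, ∑ i, partialDeriv i w z * partialDeriv i (mollify n w) z
      = -∫ z in cell, g z * mollify n w z := by
    intro n
    have h1 := h _ (contDiff_mollify hw.continuous n) (torusPeriodic_mollify hwp n)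
    rw [integral_cell_mul_laplacian hw hwp (contDiff_mollify hw.continuous n)
      (torusPeriodic_mollify hwp n)] at h1
    linarith
  have hpd : ∀ n i z, partialDeriv i (mollify n w) z = mollify n (fderiv ℝ w) z (unitVec i) := by
    intro n i z
    unfold partialDeriv
    rw [(hasFDerivAt_mollify hw hB' n z).fderiv]
  have hle : ∀ {L : Plane →L[ℝ] ℝ}, ‖L‖ ≤ B → ∀ i, ‖L (unitVec i)‖ ≤ B := by
    intro L hL i
    refine (L.le_opNorm _).trans ?_
    simpa using hL
  have l1 : Filter.Tendsto
      (fun n => ∫ z in cell, ∑ i, partialDeriv i w z * partialDeriv i (mollify n w) z)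
      Filter.atTop (nhds (∫ z in cell, ∑ i, partialDeriv i w z ^ 2)) := by
    refine tendsto_integral_of_dominated_convergence (fun _ => ∑ _i : Fin 2, B * B) (fun n => ?_)
      (integrableOn_cell continuous_const) (fun n => Filter.Eventually.of_forall fun z => ?_)
      (Filter.Eventually.of_forall fun z => ?_)
    · have hm : ContDiff ℝ 1 (mollify n w) :=
        (contDiff_mollify hw.continuous n).of_le (by norm_cast)
      exact (continuous_finsetSum _ fun i _ => (continuous_partialDeriv hw i).mul
        (continuous_partialDeriv hm i)).aestronglyMeasurable
    · refine norm_sum_le_of_le _ fun i _ => ?_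
      rw [norm_mul, hpd]
      exact mul_le_mul (hle (hB' z) i) (hle (norm_mollify_le hB' n z) i) (norm_nonneg _)
        ((norm_nonneg _).trans (hB z))
    · refine tendsto_finsetSum _ fun i _ => ?_
      simp_rw [hpd, sq]
      refine Filter.Tendsto.const_mul _ ?_
      exact ((ContinuousLinearMap.apply ℝ ℝ (unitVec i)).continuous.tendsto _).comp
        (tendsto_mollify hw' z)
  have l2 : Filter.Tendsto (fun n => -∫ z in cell, g z * mollify n w z)
      Filter.atTop (nhds (-∫ z in cell, g z * w z)) := by
    refine Filter.Tendsto.neg ?_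
    refine tendsto_integral_of_dominated_convergence (fun z => ‖g z‖ * B) (fun n => ?_)
      (integrableOn_cell (hg.norm.mul continuous_const))
      (fun n => Filter.Eventually.of_forall fun z => ?_)
      (Filter.Eventually.of_forall fun z => ?_)
    · exact (hg.mul (contDiff_mollify hw.continuous n).continuous).aestronglyMeasurable
    · rw [norm_mul]
      exact mul_le_mul_of_nonneg_left (norm_mollify_le hB n z) (norm_nonneg _)
    · exact (tendsto_mollify hw.continuous z).const_mul _
  refine tendsto_nhds_unique l1 ?_
  simp_rw [hn]
  exact l2

/-! ### Poincaré inequality near the grid -/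

lemma sq_intervalIntegral_le {f : ℝ → ℝ} (hf : Continuous f) {a b : ℝ} (hab : a ≤ b) :
    (∫ x in a..b, f x) ^ 2 ≤ (b - a) * ∫ x in a..b, f x ^ 2 := by
  rcases hab.eq_or_lt with rfl | hlt
  · simp
  set I := ∫ x in a..b, f x with hI
  have h0 : 0 ≤ ∫ x in a..b, ((b - a) * f x - I) ^ 2 :=
    intervalIntegral.integral_nonneg hab fun x _ => sq_nonneg _
  have h1 : ∫ x in a..b, ((b - a) * f x - I) ^ 2
      = (b - a) * ((b - a) * (∫ x in a..b, f x ^ 2) - I ^ 2) := by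
    have e : ∀ x, ((b - a) * f x - I) ^ 2
        = (b - a) ^ 2 * f x ^ 2 - (2 * (b - a) * I) * f x + I ^ 2 := fun x => by ring
    simp_rw [e]
    rw [intervalIntegral.integral_add, intervalIntegral.integral_sub,
      intervalIntegral.integral_const_mul, intervalIntegral.integral_const_mul,
      intervalIntegral.integral_const, ← hI, smul_eq_mul]
    · ring
    all_goals exact Continuous.intervalIntegrable (by fun_prop) _ _
  rw [h1] at h0
  have := nonneg_of_mul_nonneg_right h0 (by linarith : 0 < b - a)
  linarith

/-- Cauchy-Schwarz on the segment from x to the nearest of the zeros 0, ±1/2, whose length is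
`gridDist x`. -/
lemma sq_le_gridDist_mul {u u' : ℝ → ℝ} (hu : ∀ x, HasDerivAt u (u' x) x) (hu' : Continuous u')
    (h0 : u 0 = 0) (h1 : u (1 / 2) = 0) (h2 : u (-(1 / 2)) = 0) {x : ℝ} (hx : |x| ≤ 1 / 2) :
    u x ^ 2 ≤ gridDist x * ∫ s in period, u' s ^ 2 := by
  have key : ∀ a b, -(1 / 2) ≤ a → a ≤ b → b ≤ 1 / 2 →
      (u b - u a) ^ 2 ≤ (b - a) * ∫ s in period, u' s ^ 2 := by
    intro a b ha hab hb
    rw [← intervalIntegral.integral_eq_sub_of_hasDerivAt (fun x _ => hu x)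
      (hu'.intervalIntegrable _ _)]
    refine (sq_intervalIntegral_le hu' hab).trans ?_
    refine mul_le_mul_of_nonneg_left ?_ (by linarith)
    rw [intervalIntegral.integral_of_le hab]
    refine setIntegral_mono_set ((hu'.pow 2).intervalIntegrable _ _).1
      (Filter.Eventually.of_forall fun s => sq_nonneg _)
      (LE.le.eventuallyLE (Ioc_subset_Ioc ha hb))
  obtain ⟨hx1, hx2⟩ := abs_le.1 hx
  unfold gridDist
  rcases le_total 0 x with h | h
  · rw [abs_of_nonneg h]
    rcases min_choice x (1 / 2 - x) with e | e
    · rw [e]; have := key 0 x (by norm_num) h hx2; rw [h0] at this; simpa using this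
    · rw [e]; have := key x (1 / 2) hx1 hx2 le_rfl; rw [h1] at this; simpa using this
  · rw [abs_of_nonpos h]
    rcases min_choice (-x) (1 / 2 - -x) with e | e
    · rw [e]; have := key x 0 hx1 h (by norm_num); rw [h0] at this; simpa using this
    · rw [e]; have := key (-(1 / 2)) x le_rfl hx1 hx2; rw [h2] at this
      rw [show 1 / 2 - -x = x - -(1 / 2) by ring]; simpa using this

/-- The `δ`-neighbourhood of the half-integers in a period. -/
def strip (δ : ℝ) : Set ℝ := {x | gridDist x < δ}

lemma continuous_gridDist : Continuous gridDist := by unfold gridDist; fun_prop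

lemma measurableSet_strip (δ : ℝ) : MeasurableSet (strip δ) :=
  measurableSet_lt continuous_gridDist.measurable measurable_const

lemma volume_strip_le (δ : ℝ) :
    volume.real (period ∩ strip δ) ≤ max (4 * δ) 0 := by
  have hsub : period ∩ strip δ ⊆
      Ioo (-δ) δ ∪ (Ioc (1 / 2 - δ) (1 / 2) ∪ Ioo (-(1 / 2)) (-(1 / 2) + δ)) := by
    rintro x ⟨⟨h1, h2⟩, h3⟩
    simp only [strip, gridDist, mem_ofPred_eq, min_lt_iff] at h3
    rcases h3 with h3 | h3
    · exact Or.inl (abs_lt.1 h3)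
    · right
      rcases abs_cases x with h | h
      · exact Or.inl ⟨by linarith, h2⟩
      · exact Or.inr ⟨h1, by linarith⟩
  have h1 : volume.real (period ∩ strip δ)
      ≤ max (2 * δ) 0 + (max δ 0 + max δ 0) := by
    refine (measureReal_mono hsub (by
      simp [Real.volume_Ioo, Real.volume_Ioc, ne_eq])).trans ?_
    refine (measureReal_union_le _ _).trans ?_
    refine add_le_add ?_ ((measureReal_union_le _ _).trans (add_le_add ?_ ?_))
    · rw [measureReal_def, Real.volume_Ioo, ENNReal.toReal_ofReal']
      exact max_le_max (by linarith) le_rfl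
    · rw [measureReal_def, Real.volume_Ioc, ENNReal.toReal_ofReal']
      exact max_le_max (by linarith) le_rfl
    · rw [measureReal_def, Real.volume_Ioo, ENNReal.toReal_ofReal']
      exact max_le_max (by linarith) le_rfl
  refine h1.trans (le_of_eq ?_)
  rcases le_total δ 0 with h | h
  · rw [max_eq_right h, max_eq_right (by linarith), max_eq_right (by linarith)]; ring
  · rw [max_eq_left h, max_eq_left (by linarith), max_eq_left (by linarith)]; ring

/-- One factor δ comes from the pointwise bound, the other from the measure 4δ of the strip. -/
lemma integral_strip_sq_le {u u' : ℝ → ℝ} (hu : ∀ x, HasDerivAt u (u' x) x)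
    (hu' : Continuous u') (h0 : u 0 = 0) (h1 : u (1 / 2) = 0) (h2 : u (-(1 / 2)) = 0)
    {δ : ℝ} (hδ : 0 ≤ δ) :
    ∫ x in period, (strip δ).indicator (fun x => u x ^ 2) x
      ≤ 4 * δ ^ 2 * ∫ s in period, u' s ^ 2 := by
  have hc : Continuous u := continuous_iff_continuousAt.2 fun x => (hu x).continuousAt
  set J := ∫ s in period, u' s ^ 2 with hJ
  have hJ0 : 0 ≤ J := integral_nonneg fun s => sq_nonneg _
  have hfin : volume (period ∩ strip δ) ≠ ⊤ :=
    ((measure_mono inter_subset_left).trans_lt measure_Ioc_lt_top).ne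
  rw [setIntegral_indicator (measurableSet_strip δ)]
  calc _ ≤ ∫ _x in period ∩ strip δ, δ * J := by
        refine setIntegral_mono_on ?_ (by simpa using integrableOn_const hfin)
          (measurableSet_Ioc.inter (measurableSet_strip δ)) (fun x hx => ?_)
        · exact ((hc.pow 2).intervalIntegrable _ _).1.mono_set
            (inter_subset_left (s := period))
        · refine (sq_le_gridDist_mul hu hu' h0 h1 h2
            (abs_le.2 ⟨hx.1.1.le, hx.1.2⟩)).trans ?_
          exact mul_le_mul_of_nonneg_right (le_of_lt hx.2) hJ0
    _ = volume.real (period ∩ strip δ) * (δ * J) := by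
        rw [setIntegral_const, smul_eq_mul]
    _ ≤ 4 * δ * (δ * J) := by
        refine mul_le_mul_of_nonneg_right ?_ (by positivity)
        refine (volume_strip_le δ).trans (le_of_eq (max_eq_left (by positivity)))
    _ = _ := by ring

/-- The function vanishes on the lines where a coordinate is a half-integer. -/
def VanishesOnGrid (f : Plane → ℝ) : Prop :=
  ∀ a ∈ ({0, 1 / 2, -(1 / 2)} : Set ℝ), ∀ y, f !₂[a, y] = 0 ∧ f !₂[y, a] = 0

/-- Oddness gives the zero at 0. It also gives the zero at 1/2, because 1/2 and -1/2 are the same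
point of the circle. -/
lemma OddOdd.vanishesOnGrid {f : Plane → ℝ} (hf : OddOdd f) (hp : TorusPeriodic f) :
    VanishesOnGrid f := by
  have h0 : ∀ y, f !₂[0, y] = 0 ∧ f !₂[y, 0] = 0 := by
    intro y
    have h1 := (hf 0 y).1
    have h2 := (hf y 0).2
    rw [neg_zero] at h1 h2
    constructor <;> linarith
  have hhalf : ∀ y, f !₂[1 / 2, y] = 0 ∧ f !₂[y, 1 / 2] = 0 := by
    intro y
    have h1 := (hf (1 / 2) y).1
    have h2 := (hf y (1 / 2)).2
    have h3 := (hp (-(1 / 2)) y).1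
    have h4 := (hp y (-(1 / 2))).2
    rw [show -(1 / 2) + 1 = (1 / 2 : ℝ) by norm_num] at h3 h4
    constructor <;> linarith
  rintro a (rfl | rfl | rfl) y
  · exact h0 y
  · exact hhalf y
  · have h1 := (hf (1 / 2) y).1
    have h2 := (hf y (1 / 2)).2
    have h3 := hhalf y
    constructor <;> linarith [h3.1, h3.2]

/-- The part of the plane where a given coordinate is close to the half-integers. -/
def planeStrip (i : Fin 2) (δ : ℝ) : Set Plane := {z | z i ∈ strip δ}

lemma measurableSet_planeStrip (i : Fin 2) (δ : ℝ) : MeasurableSet (planeStrip i δ) :=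
  (by fun_prop : Continuous fun z : Plane => z i).measurable (measurableSet_strip δ)

lemma integrableOn_cell_indicator {f : Plane → ℝ} (hf : Continuous f) {A : Set Plane}
    (hA : MeasurableSet A) : IntegrableOn (A.indicator f) cell :=
  Integrable.indicator (integrableOn_cell hf) hA

lemma integrableOn_period_prod_of_cell {f : Plane → ℝ} (hf : IntegrableOn f cell) :
    IntegrableOn (fun p : ℝ × ℝ => f !₂[p.1, p.2]) (period ×ˢ period) := by
  rwa [← measurePreserving_planeEquiv.integrableOn_comp_preimage planeEquiv.measurableEmbedding,
    planeEquiv_preimage_cell] at hf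

/-- The Poincaré inequality in a thin neighbourhood of the grid. -/
lemma integral_cell_planeStrip_sq_le {w : Plane → ℝ} (hw : ContDiff ℝ 1 w)
    (hg : VanishesOnGrid w) {δ : ℝ} (hδ : 0 ≤ δ) (i : Fin 2) :
    ∫ z in cell, (planeStrip i δ).indicator (fun z => w z ^ 2) z
      ≤ 4 * δ ^ 2 * ∫ z in cell, partialDeriv i w z ^ 2 := by
  have hi1 := integrableOn_period_prod_of_cell
    (integrableOn_cell_indicator (f := fun z => w z ^ 2) (hw.continuous.pow 2) (measurableSet_planeStrip i δ))
  have hc := (continuous_partialDeriv hw i)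
  have hi2 := integrableOn_period_prod_of_cell
    (integrableOn_cell (f := fun z => partialDeriv i w z ^ 2) (hc.pow 2))
  have hcp := hc.comp continuous_pair
  rw [setIntegral_cell, setIntegral_cell]
  fin_cases i
  · rw [setIntegral_period_prod_symm hi1, setIntegral_period_prod_symm hi2, ← integral_const_mul]
    rw [IntegrableOn, Measure.volume_eq_prod, ← Measure.prod_restrict] at hi1 hi2
    refine integral_mono hi1.integral_prod_right (hi2.integral_prod_right.const_mul _) fun y => ?_
    refine le_trans (le_of_eq ?_) (integral_strip_sq_le (u := fun x => w !₂[x, y])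
      (fun x => hasDerivAt_left hw x y)
      (hcp.comp (by fun_prop : Continuous fun x : ℝ => (x, y))) ?_ ?_ ?_ hδ)
    · rfl
    · exact (hg 0 (by simp) y).1
    · exact (hg (1 / 2) (by simp) y).1
    · exact (hg (-(1 / 2)) (by simp) y).1
  · rw [Measure.volume_eq_prod] at hi1 hi2 ⊢
    rw [setIntegral_prod _ hi1, setIntegral_prod _ hi2, ← integral_const_mul]
    rw [IntegrableOn, ← Measure.prod_restrict] at hi1 hi2
    refine integral_mono hi1.integral_prod_left (hi2.integral_prod_left.const_mul _) fun x => ?_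
    refine le_trans (le_of_eq ?_) (integral_strip_sq_le (u := fun y => w !₂[x, y])
      (fun y => hasDerivAt_right hw x y)
      (hcp.comp (by fun_prop : Continuous fun y : ℝ => (x, y))) ?_ ?_ ?_ hδ)
    · rfl
    · exact (hg 0 (by simp) x).2
    · exact (hg (1 / 2) (by simp) x).2
    · exact (hg (-(1 / 2)) (by simp) x).2

/-! ### Vanishing of weak solutions with source near the grid -/

lemma TorusPeriodic.add_int {f : Plane → ℝ} (hf : TorusPeriodic f) (x y : ℝ) (m n : ℤ) :
    f !₂[x + m, y + n] = f !₂[x, y] := by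
  have h1 : ∀ y, Function.Periodic (fun x => f !₂[x, y]) 1 := fun y x => (hf x y).1
  have h2 : ∀ x, Function.Periodic (fun y => f !₂[x, y]) 1 := fun x y => (hf x y).2
  have e1 := (h1 (y + n)).int_mul m x
  have e2 := (h2 x).int_mul n y
  simp only [mul_one] at e1 e2
  rw [e1, e2]

lemma TorusPeriodic.eq_zero_of_cell {f : Plane → ℝ} (hf : TorusPeriodic f)
    (h : ∀ x ∈ period, ∀ y ∈ period, f !₂[x, y] = 0) : f = 0 := by
  funext z
  have hz : z = !₂[z 0, z 1] := by ext j; fin_cases j <;> rfl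
  have hm : ∀ x : ℝ, x - (⌈x - 1 / 2⌉ : ℤ) ∈ period := by
    intro x
    have h1 := Int.le_ceil (x - 1 / 2)
    have h2 := Int.ceil_lt_add_one (x - 1 / 2)
    exact ⟨by linarith, by linarith⟩
  have := hf.add_int (z 0 - (⌈z 0 - 1 / 2⌉ : ℤ)) (z 1 - (⌈z 1 - 1 / 2⌉ : ℤ))
    ⌈z 0 - 1 / 2⌉ ⌈z 1 - 1 / 2⌉
  rw [sub_add_cancel, sub_add_cancel, ← hz, h _ (hm _) _ (hm _)] at this
  exact this

lemma eq_zero_of_integral_cell_sq {w : Plane → ℝ} (hw : Continuous w) (hp : TorusPeriodic w)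
    (hg : VanishesOnGrid w) (h : ∫ z in cell, w z ^ 2 = 0) : w = 0 := by
  rw [setIntegral_eq_zero_iff_of_nonneg_ae (Filter.Eventually.of_forall fun z => sq_nonneg _)
    (integrableOn_cell (hw.pow 2))] at h
  set U : Set Plane := {z | ∀ i, z i ∈ Ioo (-(1 / 2) : ℝ) (1 / 2)} with hU
  have hUo : IsOpen U := by
    have : U = ⋂ i, {z : Plane | z i ∈ Ioo (-(1 / 2) : ℝ) (1 / 2)} := by ext z; simp [hU]
    rw [this]
    exact isOpen_iInter_of_finite fun i => isOpen_Ioo.preimage (by fun_prop)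
  have hUc : U ⊆ cell := fun z hz i => Ioo_subset_Ioc_self (hz i)
  have hae : w =ᵐ[volume.restrict U] 0 := by
    filter_upwards [ae_restrict_of_ae_restrict_of_subset hUc h] with z hz
    simpa using hz
  have heq := Measure.eqOn_open_of_ae_eq hae hUo hw.continuousOn continuousOn_const
  refine hp.eq_zero_of_cell fun x hx y hy => ?_
  rcases hx.2.eq_or_lt with rfl | hx2
  · exact (hg (1 / 2) (by simp) y).1
  rcases hy.2.eq_or_lt with rfl | hy2
  · exact (hg (1 / 2) (by simp) x).2
  refine heq (fun i => ?_)
  fin_cases i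
  · exact ⟨hx.1, hx2⟩
  · exact ⟨hy.1, hy2⟩

/-- A weak solution of `Δ w = g`, where `g` is dominated by `w` near the grid and vanishes
elsewhere, vanishes. -/
lemma eq_zero_of_weak_solution {w g : Plane → ℝ} (hw : ContDiff ℝ 1 w) (hwp : TorusPeriodic w)
    (hgrid : VanishesOnGrid w) {B : ℝ} (hB : ∀ z, ‖w z‖ ≤ B) (hB' : ∀ z, ‖fderiv ℝ w z‖ ≤ B)
    (hg : Continuous g)
    (h : ∀ φ : Plane → ℝ, ContDiff ℝ ∞ φ → TorusPeriodic φ →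
      ∫ z in cell, w z * Laplacian.laplacian φ z = ∫ z in cell, g z * φ z)
    {L δ : ℝ} (hL : 0 ≤ L) (hδ : 0 ≤ δ) (hsmall : 4 * L * δ ^ 2 < 1)
    (hgL : ∀ z ∈ cell, |g z| ≤ L * |w z|)
    (hg0 : ∀ z ∈ cell, z ∉ planeStrip 0 δ → z ∉ planeStrip 1 δ → g z = 0) : w = 0 := by
  have hE := integral_cell_gradient_sq hw hwp hB hB' hg h
  set E := ∫ z in cell, ∑ i, partialDeriv i w z ^ 2 with hEdef
  have hsum : E = (∫ z in cell, partialDeriv 0 w z ^ 2) + ∫ z in cell, partialDeriv 1 w z ^ 2 := by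
    rw [hEdef, integral_finsetSum _ fun i _ =>
      integrableOn_cell (f := fun z => partialDeriv i w z ^ 2) ((continuous_partialDeriv hw i).pow 2), Fin.sum_univ_two]
  have hI : ∀ i, IntegrableOn ((planeStrip i δ).indicator fun z => w z ^ 2) cell := fun i =>
    integrableOn_cell_indicator (hw.continuous.pow 2) (measurableSet_planeStrip i δ)
  have hle : -∫ z in cell, g z * w z ≤ ∫ z in cell,
      (L * (planeStrip 0 δ).indicator (fun z => w z ^ 2) z
        + L * (planeStrip 1 δ).indicator (fun z => w z ^ 2) z) := by
    rw [← integral_neg]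
    refine setIntegral_mono_on (integrableOn_cell (hg.mul hw.continuous).neg)
      (((hI 0).const_mul L).add ((hI 1).const_mul L)) measurableSet_cell fun z hz => ?_
    have hpos : ∀ i, 0 ≤ L * (planeStrip i δ).indicator (fun z => w z ^ 2) z := fun i =>
      mul_nonneg hL (indicator_nonneg (fun z _ => sq_nonneg _) z)
    have hb : -(g z * w z) ≤ L * w z ^ 2 := by
      have h1 := neg_abs_le (g z * w z)
      rw [abs_mul] at h1
      have h2 := mul_le_mul_of_nonneg_right (hgL z hz) (abs_nonneg (w z))
      rw [mul_assoc, abs_mul_abs_self] at h2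
      nlinarith
    by_cases h0 : z ∈ planeStrip 0 δ
    · have := hpos 1
      rw [indicator_of_mem h0]
      linarith
    · by_cases h1 : z ∈ planeStrip 1 δ
      · have := hpos 0
        rw [indicator_of_mem h1]
        linarith
      · rw [hg0 z hz h0 h1]
        have := hpos 0
        have := hpos 1
        linarith
  rw [integral_add ((hI 0).const_mul L) ((hI 1).const_mul L), integral_const_mul,
    integral_const_mul] at hle
  have h0 := integral_cell_planeStrip_sq_le hw hgrid hδ 0
  have h1 := integral_cell_planeStrip_sq_le hw hgrid hδ 1
  have hE0 : 0 ≤ E := integral_nonneg fun z => Finset.sum_nonneg fun i _ => sq_nonneg _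
  have hEle : E ≤ 4 * L * δ ^ 2 * E := by
    have h0' := mul_le_mul_of_nonneg_left h0 hL
    have h1' := mul_le_mul_of_nonneg_left h1 hL
    calc E ≤ _ := hE.le.trans hle
      _ ≤ L * (4 * δ ^ 2 * ∫ z in cell, partialDeriv 0 w z ^ 2)
          + L * (4 * δ ^ 2 * ∫ z in cell, partialDeriv 1 w z ^ 2) := add_le_add h0' h1'
      _ = _ := by rw [hsum]; ring
  have hEz : E = 0 := by nlinarith
  refine eq_zero_of_integral_cell_sq hw.continuous hwp hgrid (le_antisymm ?_
    (integral_nonneg fun z => sq_nonneg _))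
  -- The distance to the half-integers is at most 1/4, so the strip of width 1 is the whole plane
  -- and the same inequality bounds the integral of w² by zero energy.
  have h2 := integral_cell_planeStrip_sq_le hw hgrid zero_le_one 0
  have huniv : planeStrip 0 1 = univ := by
    ext z
    simp only [planeStrip, strip, mem_ofPred_eq, mem_univ, iff_true]
    exact (gridDist_le _).trans_lt (by norm_num)
  rw [huniv, indicator_univ] at h2
  have h3 : 0 ≤ ∫ z in cell, partialDeriv 1 w z ^ 2 := integral_nonneg fun z => sq_nonneg _
  linarith

/-! ### The nonlinearity F_ε -/

lemma abs_sgn (x : ℝ) : |sgn x| = 1 := by unfold sgn; split_ifs <;> simp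

lemma measurable_sgn : Measurable sgn :=
  Measurable.ite measurableSet_Ioi measurable_const measurable_const

section Feps

variable {K : ℝ → ℝ} {ε : ℝ}

lemma IsMollifier.hasCompactSupport (hK : IsMollifier K) : HasCompactSupport K :=
  HasCompactSupport.of_support_subset_isCompact (isCompact_closedBall (0 : ℝ) 1)
    (hK.support_subset.trans Metric.ball_subset_closedBall)

lemma IsMollifier.exists_le (hK : IsMollifier K) : ∃ M, 0 < M ∧ ∀ x, K x ≤ M := by
  obtain ⟨C, hC⟩ := hK.hasCompactSupport.exists_bound_of_continuous hK.smooth.continuous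
  exact ⟨max C 1, by positivity, fun x => (le_abs_self _).trans ((hC x).trans (le_max_left _ _))⟩

lemma IsMollifier.integrable (hK : IsMollifier K) : Integrable K :=
  hK.smooth.continuous.integrable_of_hasCompactSupport hK.hasCompactSupport

lemma IsMollifier.integrable_rescale (hK : IsMollifier K) (hε : 0 < ε) :
    Integrable (rescale K ε) :=
  (hK.integrable.comp_div hε.ne').const_mul _

lemma IsMollifier.integral_rescale (hK : IsMollifier K) (hε : 0 < ε) :
    ∫ x, rescale K ε x = 1 := by
  unfold rescale
  rw [integral_const_mul, Measure.integral_comp_div, hK.integral_eq_one, abs_of_pos hε]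
  simp [hε.ne']

lemma IsMollifier.rescale_nonneg (hK : IsMollifier K) (hε : 0 < ε) (x : ℝ) :
    0 ≤ rescale K ε x :=
  mul_nonneg (by positivity) (hK.nonneg _)

lemma IsMollifier.rescale_eq_zero (hK : IsMollifier K) (hε : 0 < ε) {x : ℝ} (hx : ε ≤ |x|) :
    rescale K ε x = 0 := by
  unfold rescale
  have : K (x / ε) = 0 := by
    by_contra h
    have := hK.support_subset h
    rw [mem_ball_zero_iff, Real.norm_eq_abs, abs_div, abs_of_pos hε, div_lt_one hε] at this
    linarith
  rw [this, mul_zero]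

lemma Feps_eq (K : ℝ → ℝ) (ε x : ℝ) : Feps K ε x = -∫ s, sgn (x - s) * rescale K ε s := by
  unfold Feps
  rw [convolution_eq_swap]
  rfl

lemma integrable_sgn_mul {f : ℝ → ℝ} (hf : Integrable f) (x : ℝ) :
    Integrable (fun s => sgn (x - s) * f s) :=
  hf.bdd_mul (c := 1) (measurable_sgn.comp (measurable_const.sub measurable_id)).aestronglyMeasurable
    (Filter.Eventually.of_forall fun s => by rw [Real.norm_eq_abs, abs_sgn])

lemma Feps_of_le (hK : IsMollifier K) (hε : 0 < ε) {x : ℝ} (hx : ε ≤ x) : Feps K ε x = -1 := by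
  rw [Feps_eq, ← hK.integral_rescale hε]
  congr 2
  funext s
  rcases le_or_gt ε |s| with h | h
  · simp [hK.rescale_eq_zero hε h]
  · have : 0 < x - s := by linarith [le_abs_self s]
    simp [sgn, sub_pos.1 this]

lemma Feps_of_le_neg (hK : IsMollifier K) (hε : 0 < ε) {x : ℝ} (hx : x ≤ -ε) :
    Feps K ε x = 1 := by
  rw [Feps_eq, ← hK.integral_rescale hε, ← integral_neg]
  congr 1
  funext s
  rcases le_or_gt ε |s| with h | h
  · simp [hK.rescale_eq_zero hε h]
  · have : ¬ s < x := by linarith [neg_abs_le s]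
    simp [sgn, this]

lemma abs_sgn_sub_sgn_le {a b : ℝ} (hab : b ≤ a) (s : ℝ) :
    |sgn (a - s) - sgn (b - s)| ≤ (Ico b a).indicator (fun _ => 2) s := by
  by_cases h1 : s < a <;> by_cases h2 : s < b
  · simp [sgn, h1, h2]
  · rw [indicator_of_mem (show s ∈ Ico b a from ⟨not_lt.1 h2, h1⟩)]
    simp [sgn, h1, h2]
    norm_num
  · exact absurd (h2.trans_le hab) h1
  · simp [sgn, h1, h2]

/-- The two shifted signs differ by 2 on an interval of length |a - b|, where the rescaled kernel is
at most M/ε. -/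
lemma abs_Feps_sub_le (hK : IsMollifier K) (hε : 0 < ε) {M : ℝ} (hM : ∀ x, K x ≤ M) (a b : ℝ) :
    |Feps K ε a - Feps K ε b| ≤ 2 * M / ε * |a - b| := by
  wlog hab : b ≤ a generalizing a b
  · rw [abs_sub_comm, abs_sub_comm a]
    exact this b a (le_of_not_ge hab)
  have hi := hK.integrable_rescale hε
  rw [Feps_eq, Feps_eq, neg_sub_neg, abs_sub_comm,
    ← integral_sub (integrable_sgn_mul hi a) (integrable_sgn_mul hi b)]
  have hbound : Integrable ((Ico b a).indicator fun _ : ℝ => 2 * (M / ε)) :=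
    (integrable_indicator_iff measurableSet_Ico).2 (integrableOn_const (by simp))
  have h := norm_integral_le_of_norm_le hbound
    (f := fun s => sgn (a - s) * rescale K ε s - sgn (b - s) * rescale K ε s)
    (Filter.Eventually.of_forall fun s => ?_)
  · rw [integral_indicator measurableSet_Ico, setIntegral_const] at h
    rw [abs_of_nonneg (sub_nonneg.2 hab)]
    refine h.trans (le_of_eq ?_)
    rw [measureReal_def, Real.volume_Ico, ENNReal.toReal_ofReal (sub_nonneg.2 hab), smul_eq_mul]
    ring
  · rw [← sub_mul, norm_mul, Real.norm_eq_abs, Real.norm_eq_abs,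
      abs_of_nonneg (hK.rescale_nonneg hε s)]
    have h1 := abs_sgn_sub_sgn_le hab s
    have h2 : rescale K ε s ≤ M / ε := by
      unfold rescale
      rw [one_div, inv_mul_eq_div]
      exact div_le_div_of_nonneg_right (hM _) hε.le
    calc _ ≤ (Ico b a).indicator (fun _ => 2) s * (M / ε) :=
          mul_le_mul h1 h2 (hK.rescale_nonneg hε s)
            (indicator_nonneg (fun _ _ => by norm_num) s)
      _ = _ := by
          by_cases hs : s ∈ Ico b a <;> simp [hs]

lemma continuous_Feps (hK : IsMollifier K) (hε : 0 < ε) : Continuous (Feps K ε) := by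
  obtain ⟨M, hM0, hM⟩ := hK.exists_le
  refine (LipschitzWith.of_dist_le_mul (K := ⟨2 * M / ε, by positivity⟩) fun a b => ?_).continuous
  exact abs_Feps_sub_le hK hε hM a b

end Feps

/-! ### Pointwise bounds in the C¹ ball -/

section C1Ball

variable {f : Plane → ℝ} {R : ℝ}

lemma norm_le_of_enorm_le_ofReal {E : Type*} [NormedAddCommGroup E] (hR : 0 ≤ R) {x : E}
    (h : ‖x‖ₑ ≤ ENNReal.ofReal R) : ‖x‖ ≤ R := by
  rwa [← ofReal_norm, ENNReal.ofReal_le_ofReal_iff hR] at h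

lemma norm_le_of_c1Norm_lt (hR : 0 ≤ R) (h : c1Norm f < ENNReal.ofReal R) (z : Plane) :
    ‖f z‖ ≤ R :=
  norm_le_of_enorm_le_ofReal hR
    (((le_iSup (fun z => ‖f z‖ₑ) z).trans le_self_add).trans h.le)

lemma norm_fderiv_le_of_c1Norm_lt (hR : 0 ≤ R) (h : c1Norm f < ENNReal.ofReal R) (z : Plane) :
    ‖fderiv ℝ f z‖ ≤ R :=
  norm_le_of_enorm_le_ofReal hR
    (((le_iSup (fun z => ‖fderiv ℝ f z‖ₑ) z).trans le_add_self).trans h.le)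

lemma exists_gridDist_eq {x : ℝ} (hx : |x| ≤ 1 / 2) :
    ∃ a ∈ ({0, 1 / 2, -(1 / 2)} : Set ℝ), |x - a| = gridDist x := by
  obtain ⟨h1, h2⟩ := abs_le.1 hx
  unfold gridDist
  rcases min_choice |x| (1 / 2 - |x|) with h | h
  · exact ⟨0, by simp, by rw [h, sub_zero]⟩
  · rw [h]
    rcases abs_cases x with ⟨e, _⟩ | ⟨e, _⟩
    · exact ⟨1 / 2, by simp, by rw [e, abs_of_nonpos (by linarith)]; ring⟩
    · exact ⟨-(1 / 2), by simp, by rw [e, abs_of_nonneg (by linarith)]; ring⟩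

/-- Mean value inequality along a segment to the nearest grid line in either direction. -/
lemma norm_le_mul_gridDist (hf : ContDiff ℝ 1 f) (hg : VanishesOnGrid f)
    (hR : ∀ z, ‖fderiv ℝ f z‖ ≤ R) {x y : ℝ} (hx : |x| ≤ 1 / 2) (hy : |y| ≤ 1 / 2) :
    |f !₂[x, y]| ≤ R * gridDist x ∧ |f !₂[x, y]| ≤ R * gridDist y := by
  have key : ∀ z z' : Plane, ‖f z - f z'‖ ≤ R * ‖z - z'‖ := fun z z' =>
    Convex.norm_image_sub_le_of_norm_fderiv_le (𝕜 := ℝ)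
      (fun z _ => hf.differentiable one_ne_zero z) (fun z _ => hR z) convex_univ
      (mem_univ z') (mem_univ z)
  constructor
  · obtain ⟨a, ha, e⟩ := exists_gridDist_eq hx
    have h := key !₂[x, y] !₂[a, y]
    rw [(hg a ha y).1, sub_zero] at h
    have hn : ‖(!₂[x, y] - !₂[a, y] : Plane)‖ = |x - a| := by
      rw [EuclideanSpace.norm_eq, Fin.sum_univ_two]
      simp [Real.sqrt_sq_eq_abs]
    rwa [hn, e] at h
  · obtain ⟨a, ha, e⟩ := exists_gridDist_eq hy
    have h := key !₂[x, y] !₂[x, a]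
    rw [(hg a ha x).2, sub_zero] at h
    have hn : ‖(!₂[x, y] - !₂[x, a] : Plane)‖ = |y - a| := by
      rw [EuclideanSpace.norm_eq, Fin.sum_univ_two]
      simp [Real.sqrt_sq_eq_abs]
    rwa [hn, e] at h

end C1Ball

/-! ### Choice of the width δ -/

open Filter Topology in
-- Here L stands for -ln ε, so that e^{-L/2} = √ε. The second bound makes the radius small against
-- ε^{1/8}; the third is 4(2M/ε)δ² < 1 for the width δ of `exists_width`, both summands of δ/√ε
-- tending to 0.
lemma eventually_log_bounds {C : ℝ} (hC : 0 < C) (M : ℝ) :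
    ∀ᶠ L : ℝ in atTop, 1 < L ∧
      C * Real.exp (-L / 2) * √L * Real.log L ≤ Real.exp (-L / 8) / 3200 ∧
      8 * M * (1 / (C * √L * Real.log L) + 6400 * C * Real.log L / √L) ^ 2 < 1 := by
  have hsq : Tendsto (fun L : ℝ => √L) atTop atTop := Real.tendsto_sqrt_atTop
  have hlog := Real.tendsto_log_atTop
  have t1 : Tendsto (fun L : ℝ => L ^ 2 * Real.exp (-(3 / 8) * L)) atTop (𝓝 0) := by
    have := tendsto_rpow_mul_exp_neg_mul_atTop_nhds_zero 2 (3 / 8) (by norm_num)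
    simpa using this
  have t2 : Tendsto (fun L : ℝ => Real.log L / √L) atTop (𝓝 0) := by
    have := (isLittleO_log_rpow_atTop (r := 1 / 2) (by norm_num)).tendsto_div_nhds_zero
    simpa [Real.sqrt_eq_rpow] using this
  have t3 : Tendsto (fun L : ℝ => 1 / (C * √L * Real.log L)) atTop (𝓝 0) := by
    simp_rw [one_div]
    exact tendsto_inv_atTop_zero.comp ((hsq.const_mul_atTop hC).atTop_mul_atTop₀ hlog)
  have t4 : Tendsto (fun L : ℝ =>
      8 * M * (1 / (C * √L * Real.log L) + 6400 * C * Real.log L / √L) ^ 2) atTop (𝓝 0) := by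
    have := ((t3.add (t2.const_mul (6400 * C))).pow 2).const_mul (8 * M)
    simpa [mul_div_assoc] using this
  filter_upwards [eventually_gt_atTop 1, t4.eventually (gt_mem_nhds one_pos),
    t1.eventually (gt_mem_nhds (by positivity : 0 < 1 / (3200 * C)))] with L h1 h2 h3
  refine ⟨h1, ?_, h2⟩
  have e1 : √L ≤ L := by
    rw [Real.sqrt_le_left (by linarith)]; nlinarith
  have e2 : Real.log L ≤ L := Real.log_le_self (by linarith)
  have e3 : Real.exp (-L / 2) = Real.exp (-(3 / 8) * L) * Real.exp (-L / 8) := by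
    rw [← Real.exp_add]; congr 1; ring
  have e4 : 0 ≤ Real.log L := Real.log_nonneg h1.le
  rw [lt_div_iff₀ (by positivity)] at h3
  calc C * Real.exp (-L / 2) * √L * Real.log L
      ≤ C * Real.exp (-L / 2) * L * L := by gcongr
    _ = (L ^ 2 * Real.exp (-(3 / 8) * L) * (3200 * C)) * (Real.exp (-L / 8) / 3200) := by
        rw [e3]; ring
    _ ≤ 1 * (Real.exp (-L / 8) / 3200) := by gcongr
    _ = _ := one_mul _

/-- For small `ε` there is a width `δ`, small against `√ε`, outside which the stream function of
the patch dominates a perturbation of slope `radius C ε`. -/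
lemma exists_width {C : ℝ} (hC : 0 < C) (M : ℝ) :
    ∃ ε₀ : ℝ, 0 < ε₀ ∧ ∀ ε : ℝ, 0 < ε → ε < ε₀ → 0 < radius C ε ∧ ∃ δ : ℝ, 0 < δ ∧
      4 * (2 * M / ε) * δ ^ 2 < 1 ∧ ε ≤ δ * radius C ε ∧
      ∀ b, δ ≤ b → 0 < b → b ≤ 1 / 4 → 800 * radius C ε ≤ b * Real.log (1 / (2 * b)) := by
  obtain ⟨L₀, hL₀⟩ := Filter.eventually_atTop.1 (eventually_log_bounds hC M)
  refine ⟨Real.exp (-L₀), Real.exp_pos _, fun ε hε hε₀ => ?_⟩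
  set L := -Real.log ε with hL
  have hLL : L₀ ≤ L := by
    have := Real.log_lt_log hε hε₀
    rw [Real.log_exp] at this
    linarith
  obtain ⟨h1, h2, h3⟩ := hL₀ L hLL
  have hεL : ε = Real.exp (-L) := by rw [hL, neg_neg, Real.exp_log hε]
  have hsqrt : √ε = Real.exp (-L / 2) := by rw [hεL, Real.exp_half]
  have hlog : 0 < Real.log L := Real.log_pos h1
  have hsL : 0 < √L := Real.sqrt_pos.2 (by linarith)
  have hse : 0 < √ε := Real.sqrt_pos.2 hε
  have hss : √ε * √ε = ε := Real.mul_self_sqrt hε.le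
  have hLs : √L * √L = L := Real.mul_self_sqrt (by linarith)
  have hRdef : radius C ε = C * √ε * √L * Real.log L := rfl
  have hR : 0 < radius C ε := by rw [hRdef]; positivity
  rw [← hsqrt, ← hRdef] at h2
  -- With R the radius, the first summand of δ is ε/R, which ensures δR ≥ ε; the second is 6400R/L,
  -- which yields the lower bound 800R.
  refine ⟨hR, √ε * (1 / (C * √L * Real.log L) + 6400 * C * Real.log L / √L), by positivity,
    ?_, ?_, ?_⟩
  · refine lt_of_eq_of_lt ?_ h3
    rw [mul_pow, sq (√ε), hss]
    field_simp
    ring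
  · rw [mul_add, add_mul]
    have e : √ε * (1 / (C * √L * Real.log L)) * radius C ε = ε := by
      rw [hRdef]
      conv_rhs => rw [← hss]
      field_simp
    rw [e]
    have : 0 ≤ √ε * (6400 * C * Real.log L / √L) * radius C ε := by positivity
    linarith
  · intro b hb hb0 hb4
    -- If the logarithm is at least L/8, then b ≥ 6400R/L suffices. Otherwise b exceeds e^{-L/8}/2,
    -- a size against which R is negligible, and b ≤ 1/4 keeps the logarithm above ln 2.
    rcases le_or_gt (L / 8) (Real.log (1 / (2 * b))) with h | h
    · have hb' : 6400 * radius C ε / L ≤ b := by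
        refine le_trans ?_ hb
        rw [mul_add]
        have e : √ε * (6400 * C * Real.log L / √L) = 6400 * radius C ε / L := by
          rw [hRdef, eq_div_iff (by linarith)]
          calc √ε * (6400 * C * Real.log L / √L) * L
              = √ε * (6400 * C * Real.log L / √L) * (√L * √L) := by rw [hLs]
            _ = _ := by field_simp
        rw [e]
        have : 0 ≤ √ε * (1 / (C * √L * Real.log L)) := by positivity
        linarith
      calc 800 * radius C ε = 6400 * radius C ε / L * (L / 8) := by
            have : L ≠ 0 := by linarith
            field_simp; norm_num
        _ ≤ _ := by gcongr
    · have hb' : Real.exp (-L / 8) / 2 ≤ b := by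
        rw [Real.log_lt_iff_lt_exp (by positivity), div_lt_iff₀ (by positivity)] at h
        have e : Real.exp (-L / 8) * Real.exp (L / 8) = 1 := by
          rw [← Real.exp_add, neg_div, neg_add_cancel, Real.exp_zero]
        have := Real.exp_pos (L / 8)
        have := Real.exp_pos (-L / 8)
        nlinarith
      have hlog2 : 1 / 2 ≤ Real.log (1 / (2 * b)) := by
        have h5 : Real.log 2 ≤ Real.log (1 / (2 * b)) := by
          apply Real.log_le_log (by norm_num)
          rw [le_div_iff₀ (by positivity)]
          linarith
        linarith [Real.log_two_gt_d9]
      calc 800 * radius C ε ≤ Real.exp (-L / 8) / 2 * (1 / 2) := by linarith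
        _ ≤ _ := by gcongr

/-! ### Uniqueness -/

/-- Since ab = min(a,b) max(a,b), the bound on ψ₀ is at least (800/400) R min(a,b). One half is the
allowed perturbation, the other is at least Rδ ≥ ε. -/
lemma add_le_abs_psi0 {ε δ R : ℝ} (hδ : 0 < δ) (hεδ : ε ≤ δ * R)
    (hb : ∀ b, δ ≤ b → 0 < b → b ≤ 1 / 4 → 800 * R ≤ b * Real.log (1 / (2 * b)))
    {x y : ℝ} (hx : |x| ≤ 1 / 2) (hy : |y| ≤ 1 / 2) (hxδ : δ ≤ gridDist x)
    (hyδ : δ ≤ gridDist y) (hR : 0 ≤ R) :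
    ε + R * min (gridDist x) (gridDist y) ≤ |psi0 !₂[x, y]| := by
  refine le_trans ?_ (abs_psi0_ge hx hy)
  set a := gridDist x
  set b := gridDist y
  have h := hb (max a b) (le_max_of_le_left hxδ) (lt_max_of_lt_left (hδ.trans_le hxδ))
    (max_le (gridDist_le x) (gridDist_le y))
  have hm : δ ≤ min a b := le_min hxδ hyδ
  rw [← min_mul_max a b]
  have h1 := mul_le_mul_of_nonneg_left h (hδ.le.trans hm)
  have h2 := mul_le_mul_of_nonneg_right hm hR
  nlinarith

lemma InC1Ball.continuous {ψ : Plane → ℝ} {R : ℝ} (h : InC1Ball psi0 R ψ) : Continuous ψ := by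
  have := h.1.continuous.add continuous_psi0
  rwa [sub_add_cancel] at this

lemma InC1Ball.abs_sub_le {ψ : Plane → ℝ} {R : ℝ} (hR : 0 ≤ R) (h : InC1Ball psi0 R ψ)
    (hp : TorusPeriodic ψ) (ho : OddOdd ψ) {x y : ℝ} (hx : |x| ≤ 1 / 2) (hy : |y| ≤ 1 / 2) :
    |ψ !₂[x, y] - psi0 !₂[x, y]| ≤ R * min (gridDist x) (gridDist y) := by
  have hp' : TorusPeriodic (ψ - psi0) := fun x y => by
    simp [hp x y, torusPeriodic_psi0 x y]
  have ho' : OddOdd (ψ - psi0) := fun x y => by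
    simp only [Pi.sub_apply, ho x y, oddOdd_psi0 x y]
    constructor <;> ring
  have := norm_le_mul_gridDist h.1 (ho'.vanishesOnGrid hp')
    (norm_fderiv_le_of_c1Norm_lt hR h.2) hx hy
  rw [mul_min_of_nonneg _ _ hR]
  exact le_min this.1 this.2

lemma continuous_laplacian {φ : Plane → ℝ} (hφ : ContDiff ℝ ∞ φ) :
    Continuous (Laplacian.laplacian φ) := by
  rw [funext (laplacian_eq_sum_partialDeriv hφ)]
  exact continuous_finsetSum _ fun i _ =>
    continuous_partialDeriv ((contDiff_partialDeriv hφ i).of_le (by norm_cast)) i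

lemma SolvesLaplaceEq.sub {F : ℝ → ℝ} (hF : Continuous F) {ψ₁ ψ₂ : Plane → ℝ}
    (hc₁ : Continuous ψ₁) (hc₂ : Continuous ψ₂) (h₁ : SolvesLaplaceEq F ψ₁)
    (h₂ : SolvesLaplaceEq F ψ₂) (φ : Plane → ℝ) (hφ : ContDiff ℝ ∞ φ) (hφp : TorusPeriodic φ) :
    ∫ z in cell, (ψ₁ - ψ₂) z * Laplacian.laplacian φ z
      = ∫ z in cell, (F (ψ₁ z) - F (ψ₂ z)) * φ z := by
  have hL := continuous_laplacian hφ
  simp only [Pi.sub_apply, sub_mul]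
  have e₁ : IntegrableOn (fun z => ψ₁ z * Laplacian.laplacian φ z) cell :=
    integrableOn_cell (hc₁.mul hL)
  have e₂ : IntegrableOn (fun z => ψ₂ z * Laplacian.laplacian φ z) cell :=
    integrableOn_cell (hc₂.mul hL)
  have e₃ : IntegrableOn (fun z => F (ψ₁ z) * φ z) cell :=
    integrableOn_cell ((hF.comp hc₁).mul hφ.continuous)
  have e₄ : IntegrableOn (fun z => F (ψ₂ z) * φ z) cell :=
    integrableOn_cell ((hF.comp hc₂).mul hφ.continuous)
  rw [integral_sub e₁ e₂, integral_sub e₃ e₄, h₁ φ hφ hφp, h₂ φ hφ hφp]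

/-- Both arguments lie beyond ±ε on the side of c, where F_ε has the constant value ∓1. -/
lemma Feps_eq_of_close {K : ℝ → ℝ} (hK : IsMollifier K) {ε : ℝ} (hε : 0 < ε) {a b c r : ℝ}
    (h : ε + r ≤ |c|) (ha : |a - c| ≤ r) (hb : |b - c| ≤ r) : Feps K ε a = Feps K ε b := by
  obtain ⟨ha1, ha2⟩ := abs_le.1 ha
  obtain ⟨hb1, hb2⟩ := abs_le.1 hb
  rcases abs_cases c with ⟨e, _⟩ | ⟨e, _⟩
  · rw [Feps_of_le hK hε (by linarith), Feps_of_le hK hε (by linarith)]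
  · rw [Feps_of_le_neg hK hε (by linarith), Feps_of_le_neg hK hε (by linarith)]

/-- Uniqueness of the odd-odd solution close to the Bahouri-Chemin patch. -/
theorem eq_of_solvesLaplaceEq_of_inC1Ball {K : ℝ → ℝ} (hK : IsMollifier K) {C₁ : ℝ}
    (hC₁ : 0 < C₁) :
    ∃ ε₀ : ℝ, 0 < ε₀ ∧ ∀ ε : ℝ, 0 < ε → ε < ε₀ → ∀ ψ₁ ψ₂ : Plane → ℝ,
      TorusPeriodic ψ₁ → TorusPeriodic ψ₂ → OddOdd ψ₁ → OddOdd ψ₂ →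
      SolvesLaplaceEq (Feps K ε) ψ₁ → SolvesLaplaceEq (Feps K ε) ψ₂ →
      InC1Ball psi0 (radius C₁ ε) ψ₁ → InC1Ball psi0 (radius C₁ ε) ψ₂ → ψ₁ = ψ₂ := by
  obtain ⟨M, hM0, hM⟩ := hK.exists_le
  obtain ⟨ε₀, hε₀, H⟩ := exists_width hC₁ M
  refine ⟨ε₀, hε₀, fun ε hε hlt ψ₁ ψ₂ hp₁ hp₂ ho₁ ho₂ hs₁ hs₂ hb₁ hb₂ => ?_⟩
  obtain ⟨hR, δ, hδ, hsmall, hεδ, hwide⟩ := H ε hε hlt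
  set R := radius C₁ ε
  have hF := continuous_Feps hK hε
  have hwp : TorusPeriodic (ψ₁ - ψ₂) := fun x y => by simp [hp₁ x y, hp₂ x y]
  have hwo : OddOdd (ψ₁ - ψ₂) := fun x y => by
    simp only [Pi.sub_apply, ho₁ x y, ho₂ x y]
    constructor <;> ring
  have hwe : ψ₁ - ψ₂ = (ψ₁ - psi0) - (ψ₂ - psi0) := by abel
  have hw : ContDiff ℝ 1 (ψ₁ - ψ₂) := hwe ▸ hb₁.1.sub hb₂.1
  have hB : ∀ z, ‖(ψ₁ - ψ₂) z‖ ≤ R + R := fun z => by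
    rw [hwe]
    exact (norm_sub_le _ _).trans
      (add_le_add (norm_le_of_c1Norm_lt hR.le hb₁.2 z) (norm_le_of_c1Norm_lt hR.le hb₂.2 z))
  have hB' : ∀ z, ‖fderiv ℝ (ψ₁ - ψ₂) z‖ ≤ R + R := fun z => by
    rw [hwe, fderiv_sub (hb₁.1.differentiable one_ne_zero z)
      (hb₂.1.differentiable one_ne_zero z)]
    exact (norm_sub_le _ _).trans (add_le_add (norm_fderiv_le_of_c1Norm_lt hR.le hb₁.2 z)
      (norm_fderiv_le_of_c1Norm_lt hR.le hb₂.2 z))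
  refine sub_eq_zero.1 (eq_zero_of_weak_solution hw hwp (hwo.vanishesOnGrid hwp) hB hB'
    (g := fun z => Feps K ε (ψ₁ z) - Feps K ε (ψ₂ z))
    ((hF.comp hb₁.continuous).sub (hF.comp hb₂.continuous))
    (SolvesLaplaceEq.sub hF hb₁.continuous hb₂.continuous hs₁ hs₂)
    (L := 2 * M / ε) (by positivity) hδ.le hsmall (fun z _ => abs_Feps_sub_le hK hε hM _ _)
    (fun z hz h0 h1 => ?_))
  have hzz : z = !₂[z 0, z 1] := by ext j; fin_cases j <;> rfl
  have hx : |z 0| ≤ 1 / 2 := abs_le.2 ⟨(hz 0).1.le, (hz 0).2⟩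
  have hy : |z 1| ≤ 1 / 2 := abs_le.2 ⟨(hz 1).1.le, (hz 1).2⟩
  -- Away from both strips each solution is within R min(a,b) of ψ₀, and |ψ₀| exceeds this by at
  -- least ε.
  have hpsi := add_le_abs_psi0 hδ hεδ hwide hx hy (not_lt.1 h0) (not_lt.1 h1) hR.le
  have d₁ := hb₁.abs_sub_le hR.le hp₁ ho₁ hx hy
  have d₂ := hb₂.abs_sub_le hR.le hp₂ ho₂ hx hy
  rw [← hzz] at hpsi d₁ d₂
  exact sub_eq_zero.2 (Feps_eq_of_close hK hε hpsi d₁ d₂)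

end BahouriChemin

end

theorem mainTheorem6 (K : ℝ → ℝ) (hK : BahouriChemin.IsMollifier K)
    (C₁ : ℝ) (hC₁ : 0 < C₁) :
    ∃ ε₀ : ℝ, 0 < ε₀ ∧ ∀ ε : ℝ, 0 < ε → ε < ε₀ →
      ∀ ψ₁ ψ₂ : BahouriChemin.Plane → ℝ,
        BahouriChemin.TorusPeriodic ψ₁ → BahouriChemin.TorusPeriodic ψ₂ →
        BahouriChemin.OddOdd ψ₁ → BahouriChemin.OddOdd ψ₂ →
        BahouriChemin.SolvesLaplaceEq (BahouriChemin.Feps K ε) ψ₁ →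
        BahouriChemin.SolvesLaplaceEq (BahouriChemin.Feps K ε) ψ₂ →
        BahouriChemin.InC1Ball BahouriChemin.psi0 (BahouriChemin.radius C₁ ε) ψ₁ →
        BahouriChemin.InC1Ball BahouriChemin.psi0 (BahouriChemin.radius C₁ ε) ψ₂ →
        ψ₁ = ψ₂ := by
  exact BahouriChemin.eq_of_solvesLaplaceEq_of_inC1Ball hK hC₁
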